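/- **Setting.** For integers $m,\tau\ge 1$ put $n=m^2\tau^2$ and place $n$ qubits on an $m\tau\times m\tau$ square lattice. A *coarse-grained circuit* is a unitary $U=WV$ acting on $|0^n\rangle$. Here $W=\bigotimes W_j$ is a tensor product of $m^2$ gates on the $m^2$ disjoint $\tau\times\tau$ blocks which tile the lattice, and $V=\bigotimes V_j$ is a tensor product of $(m-1)^2$ gates on the disjoint $\tau\times\tau$ blocks obtained by shifting the tiling by half a block (by $\lfloor\tau/2\rfloor$ sites) in both directions, with the identity on the remaining boundary qubits. In the *random coarse-grained universal circuit* all gates are independent Haar-random unitaries on $\tau^2$ qubits; in the *random coarse-grained Clifford circuit* all gates are independent uniformly random $\tau^2$-qubit Clifford unitaries (uniform modulo global phases). **Long-range MIE.** Let $\psi=U|0^n\rangle$ be the output of a random circuit on a square lattice, let $A$ be a single qubit, and let $B$ be an $L\times L$ shielding region centred at $A$: $A\cup B$ is an $L\times L$ square of lattice sites centred at $A$ (for even $L$, $A$ is one of the four sites nearest to the centre) and $A\notin B$. Let $C$ be the set of all other qubits. Measure all qubits of $B$ in the computational basis, with outcome $x\in\{0,1\}^{B}$, and let $\rho_A(x)$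 be the post-measurement reduced state of $A$. A family of random circuits on square lattices has the *long-range MIE property* if there is a constant $c\in(0,1)$ such that, for every member of the family, every such $A$ and $B$, and every positive integer $L$ with $C\neq\emptyset$, $$\mathbb{E}\left[\mathrm{Tr}\,\rho_A(x)^2\right]<c,$$ where the expectation is over the random circuit and the random measurement outcome $x$. **Theorem.** There is an $n_0$ such that the family of all random coarse-grained universal circuits with $\tau\ge\sqrt{1000\log_2 m}$ and $n=m^2\tau^2\ge n_0$ has the long-range MIE property. The same statement holds for random coarse-grained Clifford circuits. -/

import Mathlib

open scoped Kronecker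

noncomputable section

namespace CoarseMIE

/-! ### Qubits, computational basis, unitaries -/

/-- Computational basis labels of the qubits indexed by `Q`. -/
abbrev Bits (Q : Type) : Type := Q → Fin 2

/-- Operators on the qubits indexed by `Q`, as matrices in the computational basis. -/
abbrev Op (Q : Type) : Type := Matrix (Bits Q) (Bits Q) ℂ

/-- The unitary group on the qubits indexed by `Q`. -/
abbrev UGroup (Q : Type) [Fintype Q] [DecidableEq Q] :=
  Matrix.unitaryGroup (Bits Q) ℂ

section Topology

variable (Q : Type) [Fintype Q] [DecidableEq Q]

instance instMeasurableSpaceUGroup : MeasurableSpace (UGroup Q) := borel _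

instance instBorelSpaceUGroup : BorelSpace (UGroup Q) := ⟨rfl⟩

instance instCompactSpaceUGroup : CompactSpace (UGroup Q) := by
  have hsub : (Matrix.unitaryGroup (Bits Q) ℂ : Set (Op Q)) ⊆
      {M : Bits Q → Bits Q → ℂ | ∀ i, M i ∈ {v : Bits Q → ℂ | ∀ j, v j ∈
        Metric.closedBall (0 : ℂ) 1}} := by
    intro M hM i j
    simpa using entry_norm_bound_of_unitary hM i j
  have hc : IsCompact {M : Bits Q → Bits Q → ℂ | ∀ i, M i ∈ {v : Bits Q → ℂ | ∀ j, v j ∈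
        Metric.closedBall (0 : ℂ) 1}} :=
    isCompact_pi_infinite fun _ => isCompact_pi_infinite fun _ => isCompact_closedBall _ _
  have hcl : IsClosed (Matrix.unitaryGroup (Bits Q) ℂ : Set (Op Q)) := by
    have h : (Matrix.unitaryGroup (Bits Q) ℂ : Set (Op Q)) = {M : Op Q | M * star M = 1} := by
      ext M
      exact Matrix.mem_unitaryGroup_iff
    rw [h]
    exact isClosed_eq (by fun_prop) continuous_const
  exact isCompact_iff_compactSpace.mp (hc.of_isClosed_subset hcl hsub)

instance instSecondCountableUGroup : SecondCountableTopology (UGroup Q) := by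
  have : SecondCountableTopology (Op Q) :=
    inferInstanceAs (SecondCountableTopology (Bits Q → Bits Q → ℂ))
  exact TopologicalSpace.Subtype.secondCountableTopology
    (Matrix.unitaryGroup (Bits Q) ℂ : Set (Op Q))

end Topology

/-! ### Haar measure on a compact group -/

/-- The Haar probability measure of a compact group. -/
def haarProb (G : Type) [Group G] [TopologicalSpace G] [IsTopologicalGroup G]
    [MeasurableSpace G] [BorelSpace G] [CompactSpace G] : MeasureTheory.Measure G :=
  MeasureTheory.Measure.haarMeasure ⊤

instance instProbHaarProb (G : Type) [Group G] [TopologicalSpace G] [IsTopologicalGroup G]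
    [MeasurableSpace G] [BorelSpace G] [CompactSpace G] :
    MeasureTheory.IsProbabilityMeasure (haarProb G) :=
  ⟨by simpa [haarProb] using
    MeasureTheory.Measure.haarMeasure_self (G := G) (K₀ := ⊤)⟩

/-! ### Pauli and Clifford groups -/

/-- The one-qubit Pauli matrices `I, X, Y, Z`. -/
def pauli : Fin 4 → Matrix (Fin 2) (Fin 2) ℂ :=
  ![1, !![0, 1; 1, 0], !![0, -Complex.I; Complex.I, 0], !![1, 0; 0, -1]]

/-- The tensor product over the qubits `q` of the one-qubit Pauli matrices `pauli (p q)`. -/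
def pauliString {Q : Type} [Fintype Q] (p : Q → Fin 4) : Op Q :=
  Matrix.of fun x y => ∏ q, pauli (p q) (x q) (y q)

/-- The underlying set of the Pauli group: Pauli strings with a phase in `{1, i, -1, -i}`. -/
def pauliGroup (Q : Type) [Fintype Q] : Set (Op Q) :=
  Set.range fun kp : Fin 4 × (Q → Fin 4) => Complex.I ^ (kp.1 : ℕ) • pauliString kp.2

/-- The Clifford group: the unitaries that normalize the Pauli group under conjugation
(all global phases are included). -/
def cliffordGroup (Q : Type) [Fintype Q] [DecidableEq Q] : Subgroup (UGroup Q) where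
  carrier := {U | ∀ P ∈ pauliGroup Q, (U : Op Q) * P * star (U : Op Q) ∈ pauliGroup Q ∧
    star (U : Op Q) * P * (U : Op Q) ∈ pauliGroup Q}
  one_mem' := by
    intro P hP
    simpa using hP
  mul_mem' := by
    intro U V hU hV P hP
    have h1 := (hU _ (hV P hP).1).1
    have h2 := (hV _ (hU P hP).2).2
    simp only [Submonoid.coe_mul, star_mul, mul_assoc] at h1 h2 ⊢
    exact ⟨h1, h2⟩
  inv_mem' := by
    intro U hU P hP
    have h := hU P hP
    have e : ((U⁻¹ : UGroup Q) : Op Q) = star (U : Op Q) := rfl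
    simp only [e, star_star]
    exact ⟨h.2, h.1⟩

instance instCompactSpaceCliffordGroup (Q : Type) [Fintype Q] [DecidableEq Q] :
    CompactSpace (cliffordGroup Q) := by
  have hfin : IsClosed (pauliGroup Q) := (Set.finite_range _).isClosed
  have hcl : IsClosed (cliffordGroup Q : Set (UGroup Q)) := by
    have h : (cliffordGroup Q : Set (UGroup Q)) = ⋂ P ∈ pauliGroup Q,
        ((fun U : UGroup Q => (U : Op Q) * P * star (U : Op Q)) ⁻¹' pauliGroup Q ∩
         (fun U : UGroup Q => star (U : Op Q) * P * (U : Op Q)) ⁻¹' pauliGroup Q) := by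
      ext U
      simp [cliffordGroup]
    rw [h]
    refine isClosed_biInter fun P _ => IsClosed.inter ?_ ?_
    · exact hfin.preimage (by fun_prop)
    · exact hfin.preimage (by fun_prop)
  exact isCompact_iff_compactSpace.mp hcl.isCompact

/-- Haar-random unitary gate. -/
def haarGate (Q : Type) [Fintype Q] [DecidableEq Q] : MeasureTheory.Measure (UGroup Q) :=
  haarProb (UGroup Q)

/-- Uniformly random Clifford gate: the law of an element of the Clifford group distributed
according to the invariant probability measure of this compact group. Modulo global phases
this is the uniform distribution on the (finite) group of Clifford gates. -/
def cliffordGate (Q : Type) [Fintype Q] [DecidableEq Q] : MeasureTheory.Measure (UGroup Q) :=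
  (haarProb (cliffordGroup Q)).map Subtype.val

instance instProbHaarGate (Q : Type) [Fintype Q] [DecidableEq Q] :
    MeasureTheory.IsProbabilityMeasure (haarGate Q) :=
  inferInstanceAs (MeasureTheory.IsProbabilityMeasure (haarProb (UGroup Q)))

instance instProbCliffordGate (Q : Type) [Fintype Q] [DecidableEq Q] :
    MeasureTheory.IsProbabilityMeasure (cliffordGate Q) :=
  MeasureTheory.Measure.isProbabilityMeasure_map measurable_subtype_coe.aemeasurable

/-! ### Applying a gate to a subset of the qubits -/

section Gate

variable {B Q : Type} [Fintype B] [Fintype Q] [DecidableEq Q]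

/-- Split a basis label of `Q` into its part on the image of `B` and the rest. -/
def splitEquiv (f : B ↪ Q) : Bits Q ≃ Bits B × Bits {q : Q // ¬ ∃ b, f b = q} :=
  (Equiv.piEquivPiSubtypeProd (fun q : Q => ∃ b, f b = q) fun _ => Fin 2).trans
    (Equiv.prodCongr
      (Equiv.arrowCongr (Equiv.ofInjective f f.injective).symm (Equiv.refl _)) (Equiv.refl _))

/-- The operator `u` acting on the qubits `f b`, `b : B`, tensored with the identity on all
other qubits of `Q`. -/
def onQubits (f : B ↪ Q) (u : Op B) : Op Q :=
  (u ⊗ₖ (1 : Op {q : Q // ¬ ∃ b, f b = q})).submatrix (splitEquiv f) (splitEquiv f)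

theorem onQubits_apply (f : B ↪ Q) (u : Op B) (x y : Bits Q) :
    onQubits f u x y =
      u (fun b => x (f b)) (fun b => y (f b)) *
        if ∀ q, (¬ ∃ b, f b = q) → x q = y q then 1 else 0 := by
  have h : ((splitEquiv f x).2 = (splitEquiv f y).2) ↔
      ∀ q, (¬ ∃ b, f b = q) → x q = y q := by
    rw [funext_iff]
    exact ⟨fun h q hq => h ⟨q, hq⟩, fun h q => h q.1 q.2⟩
  simp only [onQubits, Matrix.submatrix_apply, Matrix.kroneckerMap_apply, Matrix.one_apply, h]
  rfl

/-- `onQubits` as a homomorphism of unitary groups. -/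
def gate [DecidableEq B] (f : B ↪ Q) : UGroup B →* UGroup Q where
  toFun u := ⟨onQubits f (u : Op B), by
    rw [Matrix.mem_unitaryGroup_iff, Matrix.star_eq_conjTranspose, onQubits,
      Matrix.conjTranspose_submatrix, Matrix.submatrix_mul_equiv,
      Matrix.conjTranspose_kronecker, ← Matrix.mul_kronecker_mul,
      ← Matrix.star_eq_conjTranspose, Matrix.mem_unitaryGroup_iff.mp u.2]
    simp⟩
  map_one' := by
    apply Subtype.ext
    simp [onQubits]
  map_mul' u v := by
    apply Subtype.ext
    change onQubits f ((u : Op B) * (v : Op B)) = onQubits f (u : Op B) * onQubits f (v : Op B)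
    rw [onQubits, onQubits, onQubits, Matrix.submatrix_mul_equiv, ← Matrix.mul_kronecker_mul,
      one_mul]

theorem continuous_gate [DecidableEq B] (f : B ↪ Q) : Continuous (gate f : UGroup B → UGroup Q) := by
  refine Continuous.subtype_mk ?_ _
  refine continuous_matrix fun x y => ?_
  simp only [onQubits_apply]
  refine Continuous.mul ?_ continuous_const
  exact (continuous_subtype_val : Continuous fun u : UGroup B => (u : Op B)).matrix_elem _ _

end Gate

/-! ### Random circuits on a square lattice -/

/-- The sites of the `N × N` square lattice. -/
abbrev Site (N : ℕ) : Type := Fin N × Fin N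

/-- A random circuit on the qubits of an `N × N` square lattice, described by the law of the
unitary which it implements. -/
structure RandomCircuit2D where
  side : ℕ
  law : MeasureTheory.Measure (UGroup (Site side))
  isProb : MeasureTheory.IsProbabilityMeasure law

/-! ### Coarse-grained circuits -/

/-- The `τ × τ` block of the second layer with index `b`: its sites are
`(b.1 τ + s, b.2 τ + t)` with `s, t < τ`. -/
def blockW (m τ : ℕ) (b : Fin m × Fin m) : Site τ ↪ Site (m * τ) where
  toFun s :=
    (⟨b.1 * τ + s.1, by have := b.1.2; have := s.1.2; nlinarith⟩,
     ⟨b.2 * τ + s.2, by have := b.2.2; have := s.2.2; nlinarith⟩)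
  inj' := by
    rintro ⟨s, t⟩ ⟨s', t'⟩ h
    simp only [Prod.mk.injEq, Fin.mk.injEq, add_right_inj] at h
    exact Prod.ext (Fin.ext h.1) (Fin.ext h.2)

theorem blockV_bound {m τ c s : ℕ} (hc : c < m - 1) (hs : s < τ) :
    c * τ + τ / 2 + s < m * τ := by
  have h1 : c + 2 ≤ m := by omega
  have h2 : (c + 2) * τ ≤ m * τ := Nat.mul_le_mul_right _ h1
  have h3 : (c + 2) * τ = c * τ + 2 * τ := by ring
  omega

/-- The `τ × τ` block of the first layer with index `b`. The first layer is shifted with respect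
to the second one by half a block in both directions. -/
def blockV (m τ : ℕ) (b : Fin (m - 1) × Fin (m - 1)) : Site τ ↪ Site (m * τ) where
  toFun s :=
    (⟨b.1 * τ + τ / 2 + s.1, blockV_bound b.1.2 s.1.2⟩,
     ⟨b.2 * τ + τ / 2 + s.2, blockV_bound b.2.2 s.2.2⟩)
  inj' := by
    rintro ⟨s, t⟩ ⟨s', t'⟩ h
    simp only [Prod.mk.injEq, Fin.mk.injEq, add_right_inj] at h
    exact Prod.ext (Fin.ext h.1) (Fin.ext h.2)

/-- The tensor product of gates on blocks indexed by `Fin k × Fin k` (the blocks of one layer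
are disjoint, so that the order of the product is immaterial). -/
def layer {k τ N : ℕ} (block : Fin k × Fin k → Site τ ↪ Site N)
    (g : Fin k × Fin k → UGroup (Site τ)) : UGroup (Site N) :=
  ((List.finRange k ×ˢ List.finRange k).map fun b => gate (block b) (g b)).prod

/-- The gates of a coarse-grained circuit: first layer `V` and second layer `W`. -/
abbrev Gates (m τ : ℕ) : Type :=
  (Fin (m - 1) × Fin (m - 1) → UGroup (Site τ)) × (Fin m × Fin m → UGroup (Site τ))

/-- The unitary `W V` of the coarse-grained circuit with the given gates. -/
def coarseUnitary (m τ : ℕ) (g : Gates m τ) : UGroup (Site (m * τ)) :=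
  layer (blockW m τ) g.2 * layer (blockV m τ) g.1

theorem continuous_layer {k τ N : ℕ} (block : Fin k × Fin k → Site τ ↪ Site N) :
    Continuous (layer block) :=
  continuous_list_prod _ fun b _ => (continuous_gate (block b)).comp (continuous_apply b)

theorem continuous_coarseUnitary (m τ : ℕ) : Continuous (coarseUnitary m τ) :=
  ((continuous_layer _).comp continuous_snd).mul ((continuous_layer _).comp continuous_fst)

/-- The random coarse-grained circuit with `m × m` blocks of `τ × τ` qubits, all of whose gates
are independent with law `μ`. -/
def coarseGrained (m τ : ℕ) (μ : MeasureTheory.Measure (UGroup (Site τ)))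
    [MeasureTheory.IsProbabilityMeasure μ] : RandomCircuit2D where
  side := m * τ
  law := ((MeasureTheory.Measure.pi fun _ : Fin (m - 1) × Fin (m - 1) => μ).prod
    (MeasureTheory.Measure.pi fun _ : Fin m × Fin m => μ)).map (coarseUnitary m τ)
  isProb := MeasureTheory.Measure.isProbabilityMeasure_map
    (continuous_coarseUnitary m τ).measurable.aemeasurable

/-- The random coarse-grained universal circuit: all gates are Haar random. -/
def coarseUniversal (m τ : ℕ) : RandomCircuit2D := coarseGrained m τ (haarGate (Site τ))

/-- The random coarse-grained Clifford circuit: all gates are uniformly random Clifford gates. -/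
def coarseClifford (m τ : ℕ) : RandomCircuit2D := coarseGrained m τ (cliffordGate (Site τ))

/-! ### Measurement and long-range measurement-induced entanglement -/

section Measurement

variable {Q : Type} [Fintype Q] [DecidableEq Q]

/-- The output state `U |0…0⟩`. -/
def outputState (U : UGroup Q) : Bits Q → ℂ := (U : Op Q).mulVec (Pi.single 0 1)

/-- The projector `|x⟩⟨x|_B ⊗ I` onto the outcome `x` of a computational basis measurement of
the qubits in `B`. -/
def outcomeProj (B : Finset Q) (x : B → Fin 2) : Op Q :=
  Matrix.diagonal fun z => if ∀ b : B, z b = x b then 1 else 0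

/-- The probability `⟨ψ| Π(x) |ψ⟩` of the outcome `x`. -/
def outcomeProb (ψ : Bits Q → ℂ) (B : Finset Q) (x : B → Fin 2) : ℝ :=
  (star ψ ⬝ᵥ (outcomeProj B x).mulVec ψ).re

/-- The basis label equal to `a` at the qubit `A` and to `y` at the other qubits. -/
def extend (A : Q) (a : Fin 2) (y : Bits {q : Q // q ≠ A}) : Bits Q :=
  fun q => if h : q = A then a else y ⟨q, h⟩

/-- The partial trace over all qubits except `A`. -/
def reduceTo (A : Q) (ρ : Op Q) : Matrix (Fin 2) (Fin 2) ℂ :=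
  Matrix.of fun a a' => ∑ y : Bits {q : Q // q ≠ A}, ρ (extend A a y) (extend A a' y)

/-- The state of the qubit `A` after the measurement of `B` with outcome `x`, that is
`Tr_{Q ∖ A} (Π(x) |ψ⟩⟨ψ| Π(x)) / ⟨ψ| Π(x) |ψ⟩` (relevant only if the outcome has nonzero
probability). -/
def postState (ψ : Bits Q → ℂ) (A : Q) (B : Finset Q) (x : B → Fin 2) :
    Matrix (Fin 2) (Fin 2) ℂ :=
  ((outcomeProb ψ B x : ℂ)⁻¹) •
    reduceTo A (outcomeProj B x * Matrix.vecMulVec ψ (star ψ) * outcomeProj B x)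

/-- The purity `Tr ρ²`. -/
def purity (ρ : Matrix (Fin 2) (Fin 2) ℂ) : ℝ := (ρ * ρ).trace.re

/-- The expectation of the purity of the post-measurement state of `A` over the outcome of the
measurement of `B` in the state `U |0…0⟩`. -/
def meanPurity (A : Q) (B : Finset Q) (U : UGroup Q) : ℝ :=
  ∑ x : B → Fin 2,
    outcomeProb (outputState U) B x * purity (postState (outputState U) A B x)

end Measurement

/-- The square `{i, …, i + L - 1} × {j, …, j + L - 1}` of sites. -/
def square {N : ℕ} (i j L : ℕ) : Finset (Site N) :=
  Finset.univ.filter fun q =>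
    (i ≤ (q.1 : ℕ) ∧ (q.1 : ℕ) < i + L) ∧ (j ≤ (q.2 : ℕ) ∧ (q.2 : ℕ) < j + L)

/-- `B` is an `L × L` shielding region centred at `A`: together with `A` it is an `L × L` square
of lattice sites which has `A` at its centre. For even `L` a square has no central site, and
each of the four sites closest to the centre is allowed. -/
def IsShieldingRegion {N : ℕ} (A : Site N) (L : ℕ) (B : Finset (Site N)) : Prop :=
  ∃ i j : ℕ, i + L ≤ N ∧ j + L ≤ N ∧
    |2 * ((A.1 : ℤ) - i) - ((L : ℤ) - 1)| ≤ 1 ∧ |2 * ((A.2 : ℤ) - j) - ((L : ℤ) - 1)| ≤ 1 ∧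
    B = (square i j L).erase A

/-- The long-range MIE property of a family of random circuits on square lattices: the expected
purity of the qubit `A` after the measurement of a shielding region `B` is smaller than a constant
`c < 1`, which depends neither on the member of the family nor on `A`, `L` or `B`, provided that
the complement `C` of `A ∪ B` is not empty. -/
def LongRangeMIE {ι : Type*} (F : ι → RandomCircuit2D) : Prop :=
  ∃ c : ℝ, 0 < c ∧ c < 1 ∧
    ∀ (k : ι) (A : Site (F k).side) (L : ℕ) (B : Finset (Site (F k).side)),
      0 < L → IsShieldingRegion A L B → (insert A B)ᶜ.Nonempty →
        MeasureTheory.Integrable (meanPurity A B) (F k).law ∧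
          ∫ U, meanPurity A B U ∂(F k).law < c

/-- The admissible parameters: `m` blocks per direction, blocks of `τ × τ` qubits with
`τ ≥ √(1000 log₂ m)`, and at least `n₀` qubits in total. -/
abbrev Params (n₀ : ℕ) : Type :=
  {p : ℕ × ℕ // √(1000 * Real.logb 2 p.1) ≤ p.2 ∧ n₀ ≤ p.1 ^ 2 * p.2 ^ 2}

end CoarseMIE

end

/-! The purity of the post-measurement state is a ratio, so it is first replaced by a polynomial
bound. For an outcome of probability `p` with unnormalized purity `t`, one has `p²/2 ≤ t ≤ p²`, and
`t/p` lies below an affine function of `p` and of the excess `t - p²/2` (`purity_term_le`). With a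
threshold of order `2^{-|B|}`, it then suffices that `4^{|B|}` times the expected excess is at most
`2/5` for each outcome. The excess has degree two in `U` and degree two in its conjugate, so only
second moments of the gates matter.

Both gate laws are invariant under left multiplication by Clifford unitaries, and this alone makes
them 2-designs (`CliffordInvariant.integral_quadEntry`): Pauli conjugations kill the mixed Pauli
moments, Clifford conjugations make all nontrivial diagonal ones equal, and unitarity fixes the
remaining unknown.

Averaging both layers turns the expected excess into the partition function of an Ising-type model
(`sum_designKernel_two_layers`). Each second-layer block carries a spin, 0 for the identity and 1
for the swap of two copies, and each first-layer block couples the four spins at its corners. Equal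
spins give coupling 1; unequal ones give a coupling at most `2 · 2^{-(τ/2)²}`, since some quarter of
the block disagrees.

Three facts bound this sum by `2/5`. The observable at `A` has zero overlap with the identity, so
configurations with spin 0 on the block of `A` contribute nonpositively. The all-swap configuration
contributes at most about `3/4 · 1/2`: `A` gives `3/4` and one site of `C` gives `1/2`. All others
contain a domain wall, and since `2^{(τ/2)²} ≥ m⁴`, their total is at most `1/100`
(`partition_function_le`, `domain_wall_bound`). The mean purity is then at most `3/4 + 1/5`. -/

noncomputable section

namespace CoarseMIE

/-! ### Pauli strings -/

section PauliStrings

variable {Q : Type} [Fintype Q]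

/-- The tensor product of one-qubit matrices. -/
def tensorOp (M : Q → Matrix (Fin 2) (Fin 2) ℂ) : Op Q :=
  Matrix.of fun x y => ∏ q, M q (x q) (y q)

theorem pauliString_eq_tensorOp (p : Q → Fin 4) :
    pauliString p = tensorOp fun q => pauli (p q) := rfl

theorem tensorOp_mul [DecidableEq Q] (M N : Q → Matrix (Fin 2) (Fin 2) ℂ) :
    tensorOp M * tensorOp N = tensorOp fun q => M q * N q := by
  ext x y
  simp only [tensorOp, Matrix.mul_apply, Matrix.of_apply, ← Finset.prod_mul_distrib]
  rw [Finset.prod_univ_sum, Fintype.piFinset_univ]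

theorem tensorOp_smul (c : Q → ℂ) (M : Q → Matrix (Fin 2) (Fin 2) ℂ) :
    tensorOp (fun q => c q • M q) = (∏ q, c q) • tensorOp M := by
  ext x y
  simp [tensorOp, Finset.prod_mul_distrib]

theorem tensorOp_one [DecidableEq Q] :
    tensorOp (fun _ : Q => (1 : Matrix (Fin 2) (Fin 2) ℂ)) = 1 := by
  ext x y
  simp only [tensorOp, Matrix.of_apply, Matrix.one_apply, Finset.prod_ite_zero,
    Finset.prod_const_one, Finset.mem_univ, true_imp_iff, funext_iff]

theorem star_tensorOp (M : Q → Matrix (Fin 2) (Fin 2) ℂ) :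
    star (tensorOp M) = tensorOp fun q => star (M q) := by
  ext x y
  simp [tensorOp, Matrix.star_apply]

theorem star_pauli (i : Fin 4) : star (pauli i) = pauli i := by
  fin_cases i <;> ext a b <;> fin_cases a <;> fin_cases b <;>
    simp [pauli, Matrix.star_apply]

theorem pauli_mul_self (i : Fin 4) : pauli i * pauli i = 1 := by
  fin_cases i <;> ext a b <;> fin_cases a <;> fin_cases b <;>
    simp [pauli, Matrix.mul_apply]

/-- The sign with which two one-qubit Pauli matrices commute. -/
def commSign (i j : Fin 4) : ℤ := if i = 0 ∨ j = 0 ∨ i = j then 1 else -1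

theorem pauli_comm (i j : Fin 4) :
    pauli i * pauli j = (commSign i j : ℂ) • (pauli j * pauli i) := by
  fin_cases i <;> fin_cases j <;> ext a b <;> fin_cases a <;> fin_cases b <;>
    simp [pauli, Matrix.mul_apply, commSign]

theorem exists_pauli_mul (i j : Fin 4) :
    ∃ (k : ℕ) (l : Fin 4), pauli i * pauli j = Complex.I ^ k • pauli l := by
  fin_cases i <;> fin_cases j
  · exact ⟨0, 0, by simp [pauli]⟩
  · exact ⟨0, 1, by simp [pauli]⟩
  · exact ⟨0, 2, by simp [pauli]⟩
  · exact ⟨0, 3, by simp [pauli]⟩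
  · exact ⟨0, 1, by simp [pauli]⟩
  · exact ⟨0, 0, by rw [pow_zero, one_smul]; exact pauli_mul_self 1⟩
  · exact ⟨1, 3, by simp [pauli]⟩
  · exact ⟨3, 2, by simp [pauli, pow_succ]⟩
  · exact ⟨0, 2, by simp [pauli]⟩
  · exact ⟨3, 3, by simp [pauli, pow_succ]⟩
  · exact ⟨0, 0, by rw [pow_zero, one_smul]; exact pauli_mul_self 2⟩
  · exact ⟨1, 1, by simp [pauli]⟩
  · exact ⟨0, 3, by simp [pauli]⟩
  · exact ⟨1, 2, by simp [pauli]⟩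
  · exact ⟨3, 1, by simp [pauli, pow_succ]⟩
  · exact ⟨0, 0, by rw [pow_zero, one_smul]; exact pauli_mul_self 3⟩

theorem sum_pauli_mul (a b c d : Fin 2) :
    ∑ i, pauli i a b * pauli i c d = if a = d ∧ b = c then 2 else 0 := by
  have h0 : pauli 0 = 1 := rfl
  have h1 : pauli 1 = !![0, 1; 1, 0] := rfl
  have h2 : pauli 2 = !![0, -Complex.I; Complex.I, 0] := rfl
  have h3 : pauli 3 = !![1, 0; 0, -1] := rfl
  rw [Fin.sum_univ_four, h0, h1, h2, h3]
  fin_cases a <;> fin_cases b <;> fin_cases c <;> fin_cases d <;> norm_num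

theorem star_pauliString (p : Q → Fin 4) : star (pauliString p) = pauliString p := by
  simp only [pauliString_eq_tensorOp, star_tensorOp, star_pauli]

/-- Tensor power of the one-qubit completeness relation: the sum of `P ⊗ P` over all Paulis is a
multiple of the swap. It yields both the Pauli expansion of matrix units and the constraint that
fixes the second moment. -/
theorem sum_pauliString_mul (x y x' y' : Bits Q) [DecidableEq Q] :
    ∑ p : Q → Fin 4, pauliString p x y * pauliString p x' y' =
      if x = y' ∧ y = x' then 2 ^ Fintype.card Q else 0 := by
  simp only [pauliString, Matrix.of_apply, ← Finset.prod_mul_distrib]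
  have h := Finset.prod_univ_sum (fun _ : Q => (Finset.univ : Finset (Fin 4)))
    fun q i => pauli i (x q) (y q) * pauli i (x' q) (y' q)
  rw [Fintype.piFinset_univ] at h
  rw [← h]
  simp only [sum_pauli_mul, Finset.prod_ite_zero, Finset.mem_univ, true_imp_iff, funext_iff,
    forall_and, Finset.prod_const, Finset.card_univ]

section

variable [DecidableEq Q]

theorem pauliString_mul_self (p : Q → Fin 4) : pauliString p * pauliString p = 1 := by
  simp only [pauliString_eq_tensorOp, tensorOp_mul, pauli_mul_self, tensorOp_one]

theorem pauliString_zero : pauliString (0 : Q → Fin 4) = 1 := by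
  rw [pauliString_eq_tensorOp, ← tensorOp_one]
  rfl

theorem pauliString_comm (p r : Q → Fin 4) :
    pauliString p * pauliString r =
      ((∏ q, commSign (p q) (r q) : ℤ) : ℂ) • (pauliString r * pauliString p) := by
  simp only [pauliString_eq_tensorOp, tensorOp_mul]
  conv_lhs => enter [1, q]; rw [pauli_comm]
  rw [tensorOp_smul]
  push_cast
  rfl

end

theorem I_pow_smul_mem_pauliGroup (k : ℕ) (p : Q → Fin 4) :
    Complex.I ^ k • pauliString p ∈ pauliGroup Q := by
  refine ⟨(⟨k % 4, Nat.mod_lt _ (by norm_num)⟩, p), ?_⟩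
  simp only
  rw [← Complex.I_pow_eq_pow_mod]

theorem pauliString_mem_pauliGroup (p : Q → Fin 4) : pauliString p ∈ pauliGroup Q := by
  simpa using I_pow_smul_mem_pauliGroup 0 p

theorem I_pow_smul_mem_of_mem (k : ℕ) {P : Op Q} (hP : P ∈ pauliGroup Q) :
    Complex.I ^ k • P ∈ pauliGroup Q := by
  obtain ⟨⟨j, p⟩, rfl⟩ := hP
  simp only [smul_smul, ← pow_add]
  exact I_pow_smul_mem_pauliGroup _ _

theorem neg_mem_pauliGroup {P : Op Q} (hP : P ∈ pauliGroup Q) : -P ∈ pauliGroup Q := by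
  simpa using I_pow_smul_mem_of_mem 2 hP

theorem mul_mem_pauliGroup [DecidableEq Q] {P R : Op Q} (hP : P ∈ pauliGroup Q)
    (hR : R ∈ pauliGroup Q) : P * R ∈ pauliGroup Q := by
  obtain ⟨⟨j, p⟩, rfl⟩ := hP
  obtain ⟨⟨k, r⟩, rfl⟩ := hR
  simp only [smul_mul_smul_comm, ← pow_add]
  refine I_pow_smul_mem_of_mem _ ?_
  choose K l h using exists_pauli_mul
  simp only [pauliString_eq_tensorOp, tensorOp_mul, h]
  rw [tensorOp_smul, Finset.prod_pow_eq_pow_sum]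
  exact I_pow_smul_mem_pauliGroup _ _

end PauliStrings

/-! ### Clifford unitaries -/

section Clifford

variable {Q : Type} [Fintype Q]

theorem commSign_prod_eq (p r : Q → Fin 4) :
    ∏ q, commSign (p q) (r q) = 1 ∨ ∏ q, commSign (p q) (r q) = -1 := by
  rw [← Int.isUnit_iff]
  refine IsUnit.prod_univ_iff.2 fun q => ?_
  rw [Int.isUnit_iff, commSign]
  split_ifs <;> simp

variable [DecidableEq Q]

/-- A Pauli string as a unitary. -/
def pauliUnitary (p : Q → Fin 4) : UGroup Q :=
  ⟨pauliString p, Matrix.mem_unitaryGroup_iff.2 (by rw [star_pauliString, pauliString_mul_self])⟩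

theorem pauliUnitary_mem_cliffordGroup (p : Q → Fin 4) : pauliUnitary p ∈ cliffordGroup Q := by
  intro P hP
  have h := mul_mem_pauliGroup (mul_mem_pauliGroup (pauliString_mem_pauliGroup p) hP)
    (pauliString_mem_pauliGroup p)
  simp only [pauliUnitary, star_pauliString]
  exact ⟨h, h⟩

theorem star_pauliUnitary_conj (p r : Q → Fin 4) :
    star (pauliUnitary r : Op Q) * pauliString p * (pauliUnitary r : Op Q) =
      ((∏ q, commSign (p q) (r q) : ℤ) : ℂ) • pauliString p := by
  simp only [pauliUnitary, star_pauliString]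
  rw [mul_assoc, pauliString_comm, mul_smul_comm, ← mul_assoc, pauliString_mul_self, one_mul]

/-- If two Pauli strings anticommute, a Clifford unitary conjugates one into the other. -/
theorem exists_clifford_of_anticomm {p r : Q → Fin 4}
    (h : ∏ q, commSign (p q) (r q) = -1) :
    ∃ c ∈ cliffordGroup Q,
      star (c : Op Q) * pauliString p * (c : Op Q) = pauliString r := by
  have hpr : pauliString p * pauliString r = -(pauliString r * pauliString p) := by
    rw [pauliString_comm, h]; simp
  set P := pauliString p with hP
  set R := pauliString r with hR
  have hPP : P * P = 1 := pauliString_mul_self p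
  have hRR : R * R = 1 := pauliString_mul_self r
  -- The Clifford is `(P + R)/√2`: it is self-adjoint, and anticommutation gives `(P + R)² = 2`.
  set a : ℂ := ((√2 : ℝ) : ℂ)⁻¹ with ha
  have haa : a * a = 1 / 2 := by
    rw [ha, ← mul_inv, ← Complex.ofReal_mul, Real.mul_self_sqrt (by norm_num)]; norm_num
  have hstar : star (a • (P + R)) = a • (P + R) := by
    rw [star_smul, star_add, hP, hR, star_pauliString, star_pauliString, ha]
    simp
  have hconj : ∀ X : Op Q, (a • (P + R)) * X * (a • (P + R)) =
      (1 / 2 : ℂ) • ((P + R) * X * (P + R)) := by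
    intro X
    rw [smul_mul_assoc, smul_mul_assoc, mul_smul_comm, smul_smul, haa]
  have hsq : (P + R) * (P + R) = (2 : ℂ) • 1 := by
    rw [add_mul, mul_add, mul_add, hPP, hRR, hpr, two_smul]
    abel
  have hu : (a • (P + R)) * star (a • (P + R)) = 1 := by
    have := hconj 1
    rw [mul_one, mul_one, hsq, smul_smul] at this
    rw [hstar, this]
    norm_num
  refine ⟨⟨a • (P + R), Matrix.mem_unitaryGroup_iff.2 hu⟩, ?_, ?_⟩
  · intro X hX
    simp only [hstar, hconj, and_self]
    obtain ⟨⟨k, x⟩, rfl⟩ := hX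
    simp only [mul_smul_comm, smul_mul_assoc]
    rw [smul_comm]
    refine I_pow_smul_mem_of_mem _ ?_
    set X := pauliString x with hX
    have hmem : ∀ {A B : Op Q}, A ∈ pauliGroup Q → B ∈ pauliGroup Q → A * B ∈ pauliGroup Q :=
      mul_mem_pauliGroup
    have mP : P ∈ pauliGroup Q := pauliString_mem_pauliGroup p
    have mR : R ∈ pauliGroup Q := pauliString_mem_pauliGroup r
    have mX : X ∈ pauliGroup Q := pauliString_mem_pauliGroup x
    -- For signs `s`, `t` only one term survives: `±2 X` if they agree and `±2 P R X` if not. The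
    -- prefactor `1/2` brings both into the Pauli group.
    have key : ∀ s t : ℤ, X * P = (s : ℂ) • (P * X) → X * R = (t : ℂ) • (R * X) →
        (P + R) * X * (P + R) =
          ((s : ℂ) + t) • X + ((t : ℂ) - s) • (P * R * X) := by
      intro s t hs ht
      have e1 : P * X * P = (s : ℂ) • X := by
        rw [mul_assoc, hs, mul_smul_comm, ← mul_assoc, hPP, one_mul]
      have e2 : R * X * R = (t : ℂ) • X := by
        rw [mul_assoc, ht, mul_smul_comm, ← mul_assoc, hRR, one_mul]
      have e3 : P * X * R = (t : ℂ) • (P * R * X) := by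
        rw [mul_assoc, ht, mul_smul_comm, ← mul_assoc]
      have e4 : R * X * P = -((s : ℂ) • (P * R * X)) := by
        rw [mul_assoc, hs, mul_smul_comm, ← mul_assoc, hpr, neg_mul, smul_neg, neg_neg]
      rw [add_mul, add_mul, mul_add, mul_add, e1, e2, e3, e4, add_smul, sub_smul]
      abel
    rcases commSign_prod_eq x p with hs | hs <;> rcases commSign_prod_eq x r with ht | ht <;>
      rw [key _ _ (pauliString_comm x p) (pauliString_comm x r), hs, ht] <;>
      norm_num [smul_smul]
    · exact mX
    · exact neg_mem_pauliGroup (hmem (hmem mP mR) mX)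
    · exact hmem (hmem mP mR) mX
    · exact neg_mem_pauliGroup mX
  · simp only [hstar, hconj]
    rw [add_mul, hPP, add_mul, mul_add, mul_assoc R P, mul_add, hPP, hpr, mul_add, mul_neg,
      ← mul_assoc R R P, hRR, mul_one]
    simp only [one_mul]
    rw [show P + R + (R + -P) = (2 : ℂ) • R by rw [two_smul]; abel, smul_smul]
    norm_num

theorem exists_commSign_eq_neg_one {i : Fin 4} (hi : i ≠ 0) : ∃ j, commSign i j = -1 := by
  revert i; decide

theorem exists_commSign_eq_neg_one₂ {i i' : Fin 4} (hi : i ≠ 0) (hi' : i' ≠ 0) :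
    ∃ j, commSign i j = -1 ∧ commSign i' j = -1 := by
  revert i i'; decide

theorem exists_commSign_ne {i i' : Fin 4} (h : i ≠ i') :
    ∃ j, commSign i j ≠ commSign i' j := by
  revert i i'; decide

theorem commSign_zero_right (i : Fin 4) : commSign i 0 = 1 := by simp [commSign]

theorem commSign_zero_left (i : Fin 4) : commSign 0 i = 1 := by simp [commSign]

theorem prod_commSign_single (p : Q → Fin 4) (q : Q) (j : Fin 4) :
    ∏ q', commSign (p q') (Function.update (0 : Q → Fin 4) q j q') = commSign (p q) j := by
  rw [Finset.prod_eq_single q]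
  · simp
  · intro b _ hb
    rw [Function.update_of_ne hb]
    exact commSign_zero_right _
  · simp

/-- Two nontrivial Pauli strings both anticommute with some Pauli string. -/
theorem exists_anticomm {p r : Q → Fin 4} (hp : p ≠ 0) (hr : r ≠ 0) :
    ∃ t : Q → Fin 4, ∏ q, commSign (p q) (t q) = -1 ∧ ∏ q, commSign (r q) (t q) = -1 := by
  by_cases h : ∃ q, p q ≠ 0 ∧ r q ≠ 0
  · obtain ⟨q, h1, h2⟩ := h
    obtain ⟨j, hj, hj'⟩ := exists_commSign_eq_neg_one₂ h1 h2
    exact ⟨Function.update 0 q j, by rw [prod_commSign_single, hj],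
      by rw [prod_commSign_single, hj']⟩
  -- The supports are disjoint here, so `t` is built from one anticommuting factor at a site of each
  -- support.
  · push Not at h
    obtain ⟨a, ha⟩ := Function.ne_iff.1 hp
    obtain ⟨b, hb⟩ := Function.ne_iff.1 hr
    have hab : a ≠ b := by
      rintro rfl
      exact hb (h a ha)
    have hpb : p b = 0 := by
      by_contra hc
      exact hb (h b hc)
    obtain ⟨i, hi⟩ := exists_commSign_eq_neg_one ha
    obtain ⟨j, hj⟩ := exists_commSign_eq_neg_one hb
    have key : ∀ f : Q → Fin 4, ∏ q, commSign (f q)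
        (Function.update (Function.update (0 : Q → Fin 4) b j) a i q) =
          commSign (f a) i * commSign (f b) j := by
      intro f
      rw [← Finset.prod_subset (Finset.subset_univ {a, b}), Finset.prod_pair hab]
      · simp [hab.symm]
      · intro q _ hq
        simp only [Finset.mem_insert, Finset.mem_singleton, not_or] at hq
        rw [Function.update_of_ne hq.1, Function.update_of_ne hq.2]
        exact commSign_zero_right _
    refine ⟨_, (key p).trans ?_, (key r).trans ?_⟩
    · rw [hi, hpb, commSign_zero_left, mul_one]
    · rw [h a ha, commSign_zero_left, hj, one_mul]

theorem exists_commSign_prod_ne {p r : Q → Fin 4} (h : p ≠ r) :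
    ∃ t : Q → Fin 4, ∏ q, commSign (p q) (t q) ≠ ∏ q, commSign (r q) (t q) := by
  obtain ⟨a, ha⟩ := Function.ne_iff.1 h
  obtain ⟨j, hj⟩ := exists_commSign_ne ha
  exact ⟨Function.update 0 a j, by rwa [prod_commSign_single, prod_commSign_single]⟩

end Clifford

/-! ### Second moments of Clifford-invariant random unitaries -/

section SecondMoment

open MeasureTheory

/-- The values of one qubit in four copies of the system, the last two of which are conjugated. -/
abbrev Quad : Type := Fin 4 → Fin 2

/-- The two ways to match the unconjugated copies with the conjugated ones. -/
def pairing (s : Fin 2) (k : Quad) : ℂ :=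
  if s = 0 then (if k 0 = k 2 ∧ k 1 = k 3 then 1 else 0)
  else if k 0 = k 3 ∧ k 1 = k 2 then 1 else 0

/-- Complex conjugation on the last two of the four copies. -/
def copyConj (i : Fin 4) : ℂ →+* ℂ := if i < 2 then RingHom.id ℂ else starRingEnd ℂ

variable {Q : Type}

/-- The matrix entries of `U ⊗ U ⊗ conj U ⊗ conj U`. -/
def quadEntry (U : Op Q) (z z' : Q → Quad) : ℂ :=
  ∏ i, copyConj i (U (fun q => z q i) (fun q => z' q i))

theorem quadEntry_eq (U : Op Q) (z z' : Q → Quad) :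
    quadEntry U z z' = U (fun q => z q 0) (fun q => z' q 0) * U (fun q => z q 1) (fun q => z' q 1) *
      star (U (fun q => z q 2) (fun q => z' q 2)) * star (U (fun q => z q 3) (fun q => z' q 3)) := by
  rw [quadEntry, Fin.prod_univ_four]
  rfl

variable [Fintype Q]

theorem prod_pairing_zero (z : Q → Quad) :
    ∏ q, pairing 0 (z q) = if (fun q => z q 0) = (fun q => z q 2) ∧
      (fun q => z q 1) = (fun q => z q 3) then 1 else 0 := by
  simp only [pairing, if_true, Finset.prod_ite_zero, Finset.mem_univ, true_imp_iff, funext_iff,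
    forall_and, Finset.prod_const_one]

theorem prod_pairing_one (z : Q → Quad) :
    ∏ q, pairing 1 (z q) = if (fun q => z q 0) = (fun q => z q 3) ∧
      (fun q => z q 1) = (fun q => z q 2) then 1 else 0 := by
  simp only [pairing, one_ne_zero, if_false, Finset.prod_ite_zero, Finset.mem_univ, true_imp_iff,
    funext_iff, forall_and, Finset.prod_const_one]

variable [DecidableEq Q]

/-- The law of a random unitary is invariant under left multiplication by Clifford unitaries. -/
def CliffordInvariant (μ : Measure (UGroup Q)) : Prop :=
  ∀ c ∈ cliffordGroup Q, ∀ F : UGroup Q → ℂ, Continuous F → ∫ u, F (c * u) ∂μ = ∫ u, F u ∂μ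

theorem cliffordInvariant_haarGate : CliffordInvariant (haarGate Q) := by
  intro c _ F _
  have : (haarGate Q).IsMulLeftInvariant :=
    inferInstanceAs (Measure.haarMeasure _).IsMulLeftInvariant
  exact integral_mul_left_eq_self F c

theorem cliffordInvariant_cliffordGate : CliffordInvariant (cliffordGate Q) := by
  intro c hc F hF
  have : (haarProb (cliffordGroup Q)).IsMulLeftInvariant :=
    inferInstanceAs (Measure.haarMeasure _).IsMulLeftInvariant
  have hm : AEMeasurable (Subtype.val : cliffordGroup Q → UGroup Q) (haarProb (cliffordGroup Q)) :=
    measurable_subtype_coe.aemeasurable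
  have hF' : Continuous fun u => F (c * u) := hF.comp (continuous_const_mul c)
  rw [cliffordGate, integral_map hm hF.aestronglyMeasurable,
    integral_map hm hF'.aestronglyMeasurable]
  exact integral_mul_left_eq_self (fun u : cliffordGroup Q => F u) ⟨c, hc⟩

theorem continuous_entry (x y : Bits Q) : Continuous fun u : UGroup Q => (u : Op Q) x y :=
  (continuous_subtype_val : Continuous fun u : UGroup Q => (u : Op Q)).matrix_elem x y

theorem continuous_quadEntry (z z' : Q → Quad) :
    Continuous fun u : UGroup Q => quadEntry (u : Op Q) z z' := by
  simp only [quadEntry_eq]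
  have h := fun x y : Bits Q => continuous_entry x y
  exact (((h _ _).mul (h _ _)).mul (h _ _).star).mul (h _ _).star

/-- An entry of the matrix `M` in the Heisenberg picture. -/
def conjEntry (M : Op Q) (x y : Bits Q) (u : UGroup Q) : ℂ :=
  (star (u : Op Q) * M * (u : Op Q)) x y

theorem continuous_conjEntry (M : Op Q) (x y : Bits Q) : Continuous (conjEntry M x y) :=
  Continuous.matrix_elem (by fun_prop) x y

theorem conjEntry_sum {ι : Type*} (s : Finset ι) (M : ι → Op Q) (x y : Bits Q) (u : UGroup Q) :
    conjEntry (∑ i ∈ s, M i) x y u = ∑ i ∈ s, conjEntry (M i) x y u := by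
  simp only [conjEntry, Finset.mul_sum, Finset.sum_mul, Matrix.sum_apply]

theorem conjEntry_smul (c : ℂ) (M : Op Q) (x y : Bits Q) (u : UGroup Q) :
    conjEntry (c • M) x y u = c * conjEntry M x y u := by
  simp [conjEntry]

theorem conjEntry_one (x y : Bits Q) (u : UGroup Q) :
    conjEntry 1 x y u = if x = y then 1 else 0 := by
  rw [conjEntry, mul_one, Matrix.mem_unitaryGroup_iff'.1 u.2, Matrix.one_apply]

theorem conjEntry_single (a b x y : Bits Q) (u : UGroup Q) :
    conjEntry (Matrix.single a b 1) x y u = star ((u : Op Q) a x) * (u : Op Q) b y := by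
  simp [conjEntry, Matrix.mul_apply, Matrix.single_apply, Matrix.star_apply, ite_and]

theorem conjEntry_mul_left (c : UGroup Q) (M : Op Q) (x y : Bits Q) (u : UGroup Q) :
    conjEntry M x y (c * u) = conjEntry (star (c : Op Q) * M * (c : Op Q)) x y u := by
  simp only [conjEntry, Submonoid.coe_mul, star_mul, mul_assoc]

theorem single_eq_sum_pauliString (a b : Bits Q) :
    (Matrix.single a b 1 : Op Q) =
      ∑ p : Q → Fin 4, ((2 ^ Fintype.card Q : ℂ)⁻¹ * pauliString p b a) • pauliString p := by
  ext x y
  simp only [Matrix.sum_apply, Matrix.smul_apply, smul_eq_mul, mul_assoc, ← Finset.mul_sum,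
    sum_pauliString_mul, Matrix.single_apply, and_comm (a := b = y)]
  split_ifs <;> simp

/-- The sum of `P ⊗ P` is a multiple of the swap, which commutes with `u ⊗ u`. Hence the value does
not depend on `u`, and no averaging is needed to know it. -/
theorem sum_conjEntry_pauliString (a b c d : Bits Q) (u : UGroup Q) :
    ∑ p : Q → Fin 4, conjEntry (pauliString p) a b u * conjEntry (pauliString p) c d u =
      2 ^ Fintype.card Q * if a = d ∧ b = c then 1 else 0 := by
  have h : ∀ p : Q → Fin 4,
      conjEntry (pauliString p) a b u * conjEntry (pauliString p) c d u =
        ∑ x, ∑ y, ∑ x', ∑ y', (star ((u : Op Q) x a) * (u : Op Q) y b *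
          (star ((u : Op Q) x' c) * (u : Op Q) y' d)) *
            (pauliString p x y * pauliString p x' y') := by
    intro p
    have h1 : ∀ a b, conjEntry (pauliString p) a b u =
        ∑ x, ∑ y, star ((u : Op Q) x a) * (u : Op Q) y b * pauliString p x y := by
      intro a b
      simp only [conjEntry, Matrix.mul_apply, Finset.sum_mul, Matrix.star_apply]
      rw [Finset.sum_comm]
      exact Finset.sum_congr rfl fun _ _ => Finset.sum_congr rfl fun _ _ => by ring
    rw [h1, h1, Finset.sum_mul]
    refine Finset.sum_congr rfl fun x _ => ?_
    rw [Finset.sum_mul]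
    refine Finset.sum_congr rfl fun y _ => ?_
    rw [Finset.mul_sum]
    refine Finset.sum_congr rfl fun x' _ => ?_
    rw [Finset.mul_sum]
    exact Finset.sum_congr rfl fun y' _ => by ring
  have hu : ∀ a b : Bits Q, ∑ x, star ((u : Op Q) x a) * (u : Op Q) x b =
      if a = b then 1 else 0 := by
    intro a b
    have := congrFun (congrFun (Matrix.mem_unitaryGroup_iff'.1 u.2) a) b
    rwa [Matrix.mul_apply, Matrix.one_apply] at this
  calc _ = ∑ x, ∑ y, ∑ x', ∑ y', (star ((u : Op Q) x a) * (u : Op Q) y b *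
          (star ((u : Op Q) x' c) * (u : Op Q) y' d)) *
            ∑ p : Q → Fin 4, (pauliString p x y * pauliString p x' y') := by
        simp only [h, Finset.mul_sum]
        rw [Finset.sum_comm]
        refine Finset.sum_congr rfl fun x _ => ?_
        rw [Finset.sum_comm]
        refine Finset.sum_congr rfl fun y _ => ?_
        rw [Finset.sum_comm]
        refine Finset.sum_congr rfl fun x' _ => ?_
        rw [Finset.sum_comm]
    _ = ∑ x, ∑ y, 2 ^ Fintype.card Q * ((star ((u : Op Q) x a) * (u : Op Q) x d) *
          (star ((u : Op Q) y c) * (u : Op Q) y b)) := by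
        refine Finset.sum_congr rfl fun x _ => Finset.sum_congr rfl fun y _ => ?_
        simp only [sum_pauliString_mul]
        rw [Finset.sum_eq_single y, Finset.sum_eq_single x]
        · simp; ring
        · intro y' _ hy'; simp [hy'.symm]
        · simp
        · intro x' _ hx'; simp [hx'.symm]
        · simp
    _ = _ := by
        simp only [← Finset.mul_sum, ← Finset.sum_mul, hu]
        by_cases h1 : a = d <;> by_cases h2 : b = c <;> simp [h1, h2, eq_comm]

theorem integrable_of_continuous {X E : Type*} [TopologicalSpace X] [CompactSpace X]
    [MeasurableSpace X] [BorelSpace X] [NormedAddCommGroup E] [SecondCountableTopology E]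
    {μ : Measure X} [IsFiniteMeasure μ] {F : X → E} (hF : Continuous F) : Integrable F μ :=
  hF.integrable_of_hasCompactSupport (HasCompactSupport.of_compactSpace F)

variable {μ : Measure (UGroup Q)}

/-- The second moment of two operators in the Heisenberg picture. -/
def conjMoment (μ : Measure (UGroup Q)) (a b c d : Bits Q) (M N : Op Q) : ℂ :=
  ∫ u, conjEntry M a b u * conjEntry N c d u ∂μ

theorem CliffordInvariant.conjMoment_eq (hμ : CliffordInvariant μ) (a b c d : Bits Q)
    (M N : Op Q) {g : UGroup Q} (hg : g ∈ cliffordGroup Q) :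
    conjMoment μ a b c d (star (g : Op Q) * M * (g : Op Q)) (star (g : Op Q) * N * (g : Op Q)) =
      conjMoment μ a b c d M N := by
  simp only [conjMoment, ← conjEntry_mul_left]
  exact hμ g hg (fun u => conjEntry M a b u * conjEntry N c d u)
    ((continuous_conjEntry _ _ _).mul (continuous_conjEntry _ _ _))

/-- Some Pauli string commutes with one of the two and anticommutes with the other. Conjugation by
it preserves the moment and also flips its sign. -/
theorem CliffordInvariant.conjMoment_of_ne (hμ : CliffordInvariant μ) (a b c d : Bits Q)
    {p r : Q → Fin 4} (h : p ≠ r) :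
    conjMoment μ a b c d (pauliString p) (pauliString r) = 0 := by
  obtain ⟨t, ht⟩ := exists_commSign_prod_ne h
  have key := hμ.conjMoment_eq a b c d (pauliString p) (pauliString r)
    (pauliUnitary_mem_cliffordGroup t)
  rw [star_pauliUnitary_conj, star_pauliUnitary_conj] at key
  have hs : ∀ (x y : ℂ) (M N : Op Q), conjMoment μ a b c d (x • M) (y • N) =
      x * y * conjMoment μ a b c d M N := by
    intro x y M N
    simp only [conjMoment, conjEntry_smul, ← integral_const_mul]
    exact integral_congr_ae (Filter.Eventually.of_forall fun u => by ring)
  rw [hs] at key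
  rcases commSign_prod_eq p t with h1 | h1 <;> rcases commSign_prod_eq r t with h2 | h2 <;>
    rw [h1, h2] at key ht <;> first | exact absurd rfl ht | skip
  all_goals
    push_cast at key
    linear_combination (-1 / 2 : ℂ) * key

/-- Anticommuting Paulis are Clifford conjugate, and any two nontrivial ones are linked through a
third that anticommutes with both. -/
theorem CliffordInvariant.conjMoment_diag (hμ : CliffordInvariant μ) (a b c d : Bits Q)
    {p r : Q → Fin 4} (hp : p ≠ 0) (hr : r ≠ 0) :
    conjMoment μ a b c d (pauliString p) (pauliString p) =
      conjMoment μ a b c d (pauliString r) (pauliString r) := by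
  have key : ∀ {p r : Q → Fin 4}, ∏ q, commSign (p q) (r q) = -1 →
      conjMoment μ a b c d (pauliString p) (pauliString p) =
        conjMoment μ a b c d (pauliString r) (pauliString r) := by
    intro p r h
    obtain ⟨g, hg, h⟩ := exists_clifford_of_anticomm h
    have := hμ.conjMoment_eq a b c d (pauliString p) (pauliString p) hg
    rwa [h, eq_comm] at this
  obtain ⟨t, h1, h2⟩ := exists_anticomm hp hr
  exact (key h1).trans (key h2).symm

variable [IsProbabilityMeasure μ]

theorem integrable_conjEntry_mul (a b c d : Bits Q) (M N : Op Q) :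
    Integrable (fun u => conjEntry M a b u * conjEntry N c d u) μ :=
  integrable_of_continuous ((continuous_conjEntry _ _ _).mul (continuous_conjEntry _ _ _))

theorem conjMoment_sum_smul {ι κ : Type*} [Fintype ι] [Fintype κ] (a b c d : Bits Q)
    (r : ι → ℂ) (M : ι → Op Q) (t : κ → ℂ) (N : κ → Op Q) :
    conjMoment μ a b c d (∑ i, r i • M i) (∑ j, t j • N j) =
      ∑ i, ∑ j, r i * t j * conjMoment μ a b c d (M i) (N j) := by
  simp only [conjMoment, conjEntry_sum, conjEntry_smul, Finset.sum_mul_sum, mul_mul_mul_comm]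
  rw [integral_finsetSum _ fun i _ => integrable_finsetSum _ fun j _ =>
    (integrable_conjEntry_mul a b c d (M i) (N j)).const_mul _]
  refine Finset.sum_congr rfl fun i _ => ?_
  rw [integral_finsetSum _ fun j _ => (integrable_conjEntry_mul a b c d (M i) (N j)).const_mul _]
  exact Finset.sum_congr rfl fun j _ => integral_const_mul _ _

/-- Clifford-invariant random unitaries form a 2-design. -/
theorem CliffordInvariant.integral_quadEntry [Nonempty Q] (hμ : CliffordInvariant μ)
    (z z' : Q → Quad) {D : ℂ} (hD : D = 2 ^ Fintype.card Q) :
    ∫ u : UGroup Q, quadEntry (u : Op Q) z z' ∂μ =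
      ∑ s, (∏ q, pairing s (z q)) *
        ((∏ q, pairing s (z' q) - D⁻¹ * ∏ q, pairing (s + 1) (z' q)) / (D ^ 2 - 1)) := by
  set x := fun i q => z q i with hx
  set y := fun i q => z' q i with hy
  have hD0 : D ≠ 0 := by rw [hD]; exact pow_ne_zero _ two_ne_zero
  have hD1 : D ^ 2 - 1 ≠ 0 := by
    have h2 : 1 < (2 : ℝ) ^ Fintype.card Q := one_lt_pow₀ (by norm_num) Fintype.card_ne_zero
    have h4 : ((((2 : ℝ) ^ Fintype.card Q) ^ 2 - 1 : ℝ) : ℂ) ≠ 0 :=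
      Complex.ofReal_ne_zero.2 (by nlinarith)
    rw [hD]
    exact_mod_cast h4
  have h1 : ∫ u : UGroup Q, quadEntry (u : Op Q) z z' ∂μ =
      conjMoment μ (y 2) (y 0) (y 3) (y 1) (Matrix.single (x 2) (x 0) 1)
        (Matrix.single (x 3) (x 1) 1) := by
    simp only [conjMoment, conjEntry_single, quadEntry_eq]
    refine integral_congr_ae (Filter.Eventually.of_forall fun u => ?_)
    simp only [hx, hy]
    ring
  set m := fun p : Q → Fin 4 =>
    conjMoment μ (y 2) (y 0) (y 3) (y 1) (pauliString p) (pauliString p) with hm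
  obtain ⟨p₀, hp₀⟩ : ∃ p : Q → Fin 4, p ≠ 0 := exists_ne 0
  -- Only two numbers remain: `m 0`, which is explicit because the identity is fixed by conjugation,
  -- and the common value `m p₀`.
  have hmp : ∀ p : Q → Fin 4, m p = m p₀ + if p = 0 then m 0 - m p₀ else 0 := by
    intro p
    split_ifs with h
    · rw [h]; ring
    · rw [add_zero]; exact hμ.conjMoment_diag _ _ _ _ h hp₀
  have hm0 : m 0 = if y 2 = y 0 ∧ y 3 = y 1 then 1 else 0 := by
    simp only [hm, conjMoment, pauliString_zero, conjEntry_one, integral_const, ite_and]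
    split_ifs <;> simp
  have hcard : (Fintype.card (Q → Fin 4) : ℂ) = D ^ 2 := by
    rw [hD, Fintype.card_fun, Fintype.card_fin, ← pow_mul, mul_comm, pow_mul]
    norm_num
  have hsum : ∑ p, m p = D * if y 2 = y 1 ∧ y 0 = y 3 then 1 else 0 := by
    simp only [hm, conjMoment]
    rw [← integral_finsetSum _ fun p _ => integrable_conjEntry_mul _ _ _ _ _ _]
    simp [sum_conjEntry_pauliString, hD]
  -- The deterministic sum over all Paulis supplies the linear equation that determines `m p₀`.
  have hξ : D ^ 2 * m p₀ + (m 0 - m p₀) = D * if y 2 = y 1 ∧ y 0 = y 3 then 1 else 0 := by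
    rw [← hsum, Finset.sum_congr rfl fun p _ => hmp p, Finset.sum_add_distrib]
    simp [← hcard]
  have hpauli : ∑ p : Q → Fin 4, pauliString p (x 0) (x 2) * pauliString p (x 1) (x 3) =
      D * if x 0 = x 3 ∧ x 1 = x 2 then 1 else 0 := by
    rw [sum_pauliString_mul, hD, mul_ite, mul_one, mul_zero]
    simp only [eq_comm]
  have h0 : pauliString (0 : Q → Fin 4) (x 0) (x 2) * pauliString (0 : Q → Fin 4) (x 1) (x 3) =
      if x 0 = x 2 ∧ x 1 = x 3 then 1 else 0 := by
    rw [pauliString_zero, Matrix.one_apply, Matrix.one_apply, ite_and]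
    split_ifs <;> simp
  have h2 : conjMoment μ (y 2) (y 0) (y 3) (y 1) (Matrix.single (x 2) (x 0) 1)
        (Matrix.single (x 3) (x 1) 1) =
      D⁻¹ ^ 2 * (m p₀ * (D * if x 0 = x 3 ∧ x 1 = x 2 then 1 else 0) +
        (m 0 - m p₀) * if x 0 = x 2 ∧ x 1 = x 3 then 1 else 0) := by
    rw [single_eq_sum_pauliString, single_eq_sum_pauliString, conjMoment_sum_smul, ← hpauli, ← h0]
    have : ∀ p : Q → Fin 4, ∑ r : Q → Fin 4,
        (2 ^ Fintype.card Q : ℂ)⁻¹ * pauliString p (x 0) (x 2) *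
          ((2 ^ Fintype.card Q : ℂ)⁻¹ * pauliString r (x 1) (x 3)) *
            conjMoment μ (y 2) (y 0) (y 3) (y 1) (pauliString p) (pauliString r) =
        D⁻¹ ^ 2 * (pauliString p (x 0) (x 2) * pauliString p (x 1) (x 3) * m p) := by
      intro p
      rw [Finset.sum_eq_single p]
      · simp only [hm, hD]; ring
      · intro r _ hr
        rw [hμ.conjMoment_of_ne _ _ _ _ hr.symm, mul_zero]
      · simp
    simp only [this, ← Finset.mul_sum]
    congr 1
    rw [Finset.sum_congr rfl fun p _ => by rw [hmp p]]
    simp only [mul_add, Finset.sum_add_distrib, mul_ite, mul_zero, Finset.sum_ite_eq',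
      Finset.mem_univ, if_true, ← Finset.sum_mul]
    ring
  have e0 : (y 2 = y 0 ∧ y 3 = y 1) = (y 0 = y 2 ∧ y 1 = y 3) := by simp only [eq_comm]
  have e1 : (y 2 = y 1 ∧ y 0 = y 3) = (y 0 = y 3 ∧ y 1 = y 2) := by
    rw [and_comm]; simp only [eq_comm]
  simp only [e0, e1] at hm0 hξ
  rw [Fin.sum_univ_two, h1, h2, zero_add, show (1 : Fin 2) + 1 = 0 from rfl,
    prod_pairing_zero, prod_pairing_one, prod_pairing_zero, prod_pairing_one]
  change _ = (if x 0 = x 2 ∧ x 1 = x 3 then 1 else 0) *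
      (((if y 0 = y 2 ∧ y 1 = y 3 then 1 else 0) -
        D⁻¹ * if y 0 = y 3 ∧ y 1 = y 2 then 1 else 0) / (D ^ 2 - 1)) +
      (if x 0 = x 3 ∧ x 1 = x 2 then 1 else 0) *
      (((if y 0 = y 3 ∧ y 1 = y 2 then 1 else 0) -
        D⁻¹ * if y 0 = y 2 ∧ y 1 = y 3 then 1 else 0) / (D ^ 2 - 1))
  rw [← hm0]
  generalize (if x 0 = x 2 ∧ x 1 = x 3 then (1 : ℂ) else 0) = X0
  generalize (if x 0 = x 3 ∧ x 1 = x 2 then (1 : ℂ) else 0) = X1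
  generalize (if y 0 = y 3 ∧ y 1 = y 2 then (1 : ℂ) else 0) = Y1 at hξ ⊢
  have hξ' : m p₀ = (D * Y1 - m 0) / (D ^ 2 - 1) := by
    rw [eq_div_iff hD1]; linear_combination hξ
  rw [hξ']
  field_simp
  ring

end SecondMoment

/-! ### Layers of gates -/

section Layers

open MeasureTheory

/-! ### Products of gates on disjoint blocks. -/

section Abstract

variable {ι S Q : Type} [Fintype S] [Fintype Q] [DecidableEq Q]

/-- The blocks of a family have disjoint images. -/
def DisjointBlocks (block : ι → S ↪ Q) : Prop :=
  ∀ a b, a ≠ b → ∀ s t, block a s ≠ block b t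

theorem gate_list_prod_apply [DecidableEq S] {block : ι → S ↪ Q} (hb : DisjointBlocks block)
    (g : ι → UGroup S) {l : List ι} (hl : l.Nodup) (x y : Bits Q) :
    (((l.map fun b => gate (block b) (g b)).prod : UGroup Q) : Op Q) x y =
      (l.map fun b => (g b : Op S) (fun s => x (block b s)) (fun s => y (block b s))).prod *
        if ∀ q, (∀ b ∈ l, ∀ s, block b s ≠ q) → x q = y q then 1 else 0 := by
  induction l generalizing x with
  | nil => simp [Matrix.one_apply, funext_iff]
  | cons a l ih =>
    obtain ⟨hal, hl⟩ := List.nodup_cons.1 hl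
    simp only [List.map_cons, List.prod_cons, Submonoid.coe_mul, Matrix.mul_apply]
    have hgate : ∀ x y, ((gate (block a) (g a) : UGroup Q) : Op Q) x y =
        (g a : Op S) (fun s => x (block a s)) (fun s => y (block a s)) *
          if ∀ q, (¬ ∃ s, block a s = q) → x q = y q then 1 else 0 :=
      fun x y => onQubits_apply _ _ _ _
    have hne : ∀ b ∈ l, ∀ s, ¬ ∃ t, block a t = block b s := by
      rintro b hbl s ⟨t, ht⟩
      exact hb a b (by rintro rfl; exact hal hbl) t s ht
    classical
    -- The only intermediate string with a nonzero contribution: gate `a` has already acted on its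
    -- own block and nowhere else.
    set w : Bits Q := fun q => if ∃ s, block a s = q then y q else x q with hw
    rw [Finset.sum_eq_single w]
    · rw [hgate, ih hl, if_pos (by intro q hq; simp only [hw, if_neg hq])]
      have h1 : (fun s => w (block a s)) = fun s => y (block a s) := by
        funext s
        simp only [hw, if_pos (⟨s, rfl⟩ : ∃ t, block a t = block a s)]
      have h2 : (l.map fun b => (g b : Op S) (fun s => w (block b s)) (fun s => y (block b s))) =
          l.map fun b => (g b : Op S) (fun s => x (block b s)) (fun s => y (block b s)) := by
        refine List.map_congr_left fun b hbl => ?_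
        simp only [hw, if_neg (hne b hbl _)]
      have h3 : (∀ q, (∀ b ∈ l, ∀ s, block b s ≠ q) → w q = y q) ↔
          ∀ q, (∀ b ∈ a :: l, ∀ s, block b s ≠ q) → x q = y q := by
        simp only [List.forall_mem_cons, hw]
        refine forall_congr' fun q => ?_
        by_cases hq : ∃ s, block a s = q
        · simp only [if_pos hq, implies_true, true_iff]
          rintro ⟨h, -⟩
          obtain ⟨s, hs⟩ := hq
          exact absurd hs (h s)
        · simp only [if_neg hq]
          push Not at hq
          simp [hq]
      rw [h1, h2]
      simp only [h3]
      ring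
    · intro v _ hv
      by_contra hc
      rw [hgate, ih hl] at hc
      have hc1 := right_ne_zero_of_mul (left_ne_zero_of_mul hc)
      have hc2 := right_ne_zero_of_mul (right_ne_zero_of_mul hc)
      simp only [ne_eq, ite_eq_right_iff, one_ne_zero, imp_false, not_not] at hc1 hc2
      refine hv (funext fun q => ?_)
      by_cases hq : ∃ s, block a s = q
      · simp only [hw, if_pos hq]
        refine hc2 q fun b hbl s hs => ?_
        exact hne b hbl s (hs ▸ hq)
      · simp only [hw, if_neg hq]
        exact (hc1 q hq).symm
    · simp

variable [Fintype ι]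

/-- The sites outside of all blocks. -/
abbrev Outside (block : ι → S ↪ Q) : Type := {q : Q // ∀ b s, block b s ≠ q}

/-- The sites are those in the blocks together with those outside of all blocks. -/
def blocksEquiv {block : ι → S ↪ Q} (hb : DisjointBlocks block) :
    (ι × S) ⊕ Outside block ≃ Q :=
  Equiv.ofBijective (Sum.elim (fun p => block p.1 p.2) Subtype.val) <| by
    constructor
    · rintro (⟨a, s⟩ | ⟨q, hq⟩) (⟨b, t⟩ | ⟨r, hr⟩) h
      · simp only [Sum.elim_inl] at h
        by_cases hab : a = b
        · subst hab
          rw [(block a).injective h]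
        · exact absurd h (hb a b hab s t)
      · exact absurd h (hr a s)
      · exact absurd h.symm (hq b t)
      · simp only [Sum.elim_inr] at h
        simp only [h]
    · intro q
      by_cases hq : ∃ b s, block b s = q
      · obtain ⟨b, s, rfl⟩ := hq
        exact ⟨Sum.inl (b, s), rfl⟩
      · push Not at hq
        exact ⟨Sum.inr ⟨q, hq⟩, rfl⟩

theorem prod_blocks {block : ι → S ↪ Q} [Fintype (Outside block)]
    (hb : DisjointBlocks block) {M : Type*} [CommMonoid M] (f : Q → M) :
    ∏ q, f q = (∏ b, ∏ s, f (block b s)) * ∏ q : Outside block, f q := by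
  rw [← (blocksEquiv hb).prod_comp, Fintype.prod_sum_type, Fintype.prod_prod_type]
  rfl

theorem sum_blocks [DecidableEq ι] [DecidableEq S] {block : ι → S ↪ Q} [Fintype (Outside block)]
    (hb : DisjointBlocks block) {K : Type} [Fintype K] [DecidableEq K] {R : Type*}
    [CommSemiring R] (Φ : ι → (S → K) → R) (ρ : Q → K → R) :
    ∑ z : Q → K, (∏ b, Φ b fun s => z (block b s)) * ∏ q : Outside block, ρ q (z q) =
      (∏ b, ∑ y, Φ b y) * ∏ q : Outside block, ∑ k, ρ q k := by
  let e : (Q → K) ≃ (ι → S → K) × (Outside block → K) :=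
    ((Equiv.arrowCongr (blocksEquiv hb).symm (Equiv.refl K)).trans
      (Equiv.sumArrowEquivProdArrow _ _ _)).trans
        (Equiv.prodCongr (Equiv.curry _ _ _) (Equiv.refl _))
  have he : ∀ z, (∏ b, Φ b fun s => z (block b s)) * ∏ q : Outside block, ρ q (z q) =
      (∏ b, Φ b ((e z).1 b)) * ∏ q : Outside block, ρ q ((e z).2 q) := fun z => rfl
  have h1 := Finset.prod_univ_sum (fun _ : ι => (Finset.univ : Finset (S → K))) Φ
  have h2 := Finset.prod_univ_sum (fun _ : Outside block => (Finset.univ : Finset K))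
    fun q => ρ q
  rw [Fintype.piFinset_univ] at h1 h2
  rw [Finset.sum_congr rfl fun z _ => he z,
    e.sum_comp fun y => (∏ b, Φ b (y.1 b)) * ∏ q : Outside block, ρ q (y.2 q),
    Fintype.sum_prod_type, h1, h2, Finset.sum_mul_sum]

end Abstract

/-- `U ↦ U ⊗ U ⊗ conj U ⊗ conj U` is multiplicative. This separates the two layers, so that
independence lets each be averaged on its own. -/
theorem quadEntry_mul {Q : Type} [Fintype Q] [DecidableEq Q] (M N : Op Q) (z y : Q → Quad) :
    quadEntry (M * N) z y = ∑ w : Q → Quad, quadEntry M z w * quadEntry N w y := by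
  simp only [quadEntry, Matrix.mul_apply, map_sum, ← Finset.prod_mul_distrib]
  rw [Finset.prod_univ_sum, Fintype.piFinset_univ]
  refine Fintype.sum_equiv (Equiv.piComm fun (_ : Fin 4) (_ : Q) => Fin 2) _ _ fun f => ?_
  simp only [map_mul]
  rfl

variable {k τ N : ℕ} {block : Fin k × Fin k → Site τ ↪ Site N}

theorem layer_apply (hb : DisjointBlocks block) (g : Fin k × Fin k → UGroup (Site τ))
    (x y : Bits (Site N)) :
    (layer block g : Op (Site N)) x y =
      (∏ b, (g b : Op (Site τ)) (fun s => x (block b s)) (fun s => y (block b s))) *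
        if ∀ q : Outside block, x q = y q then 1 else 0 := by
  have hl : (List.finRange k ×ˢ List.finRange k).Nodup :=
    (List.nodup_finRange k).product (List.nodup_finRange k)
  have hmem : ∀ b, b ∈ List.finRange k ×ˢ List.finRange k := fun b =>
    List.mem_product.2 ⟨List.mem_finRange _, List.mem_finRange _⟩
  rw [layer, gate_list_prod_apply hb g hl, ← List.prod_toFinset _ hl,
    Finset.eq_univ_iff_forall.2 fun b => List.mem_toFinset.2 (hmem b)]
  simp only [hmem, true_imp_iff, Subtype.forall]

theorem quadEntry_layer (hb : DisjointBlocks block) (g : Fin k × Fin k → UGroup (Site τ))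
    (z z' : Site N → Quad) :
    quadEntry (layer block g : Op (Site N)) z z' =
      (∏ b, quadEntry (g b : Op (Site τ)) (fun s => z (block b s)) (fun s => z' (block b s))) *
        ∏ q : Outside block, if z q = z' q then 1 else 0 := by
  simp only [quadEntry, layer_apply hb, map_mul, Finset.prod_mul_distrib, map_prod]
  rw [Finset.prod_comm]
  congr 1
  simp only [apply_ite (copyConj _), map_one, map_zero, Finset.prod_ite_zero, Finset.mem_univ,
    true_imp_iff, Finset.prod_const_one, funext_iff]
  simp only [forall_comm (α := Fin 4)]

theorem integral_quadEntry_layer (hb : DisjointBlocks block) (μ : Measure (UGroup (Site τ)))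
    [IsProbabilityMeasure μ] (z z' : Site N → Quad) :
    ∫ g, quadEntry (layer block g : Op (Site N)) z z' ∂(Measure.pi fun _ => μ) =
      (∏ b, ∫ u : UGroup (Site τ), quadEntry (u : Op (Site τ))
          (fun s => z (block b s)) (fun s => z' (block b s)) ∂μ) *
        ∏ q : Outside block, if z q = z' q then 1 else 0 := by
  simp only [quadEntry_layer hb]
  rw [integral_mul_const]
  congr 1
  exact integral_fintype_prod_eq_prod (μ := fun _ => μ) fun b (u : UGroup (Site τ)) =>
    quadEntry (u : Op (Site τ)) (fun s => z (block b s)) (fun s => z' (block b s))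

end Layers

/-! ### The partition function of the averaged circuit -/

section PartitionFunction

/-- Gluing two matchings of four copies leaves two loops if they agree and one if not; each loop
contributes a factor 2. -/
theorem sum_pairing_mul (s t : Fin 2) :
    ∑ k, pairing s k * pairing t k = if s = t then 4 else 2 := by
  -- Over the naturals the finite check becomes decidable.
  have h : ∀ k : Quad, pairing s k * pairing t k =
      (((if s = 0 then (if k 0 = k 2 ∧ k 1 = k 3 then 1 else 0)
        else if k 0 = k 3 ∧ k 1 = k 2 then 1 else 0) *
      (if t = 0 then (if k 0 = k 2 ∧ k 1 = k 3 then 1 else 0)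
        else if k 0 = k 3 ∧ k 1 = k 2 then 1 else 0) : ℕ) : ℂ) := by
    intro k
    simp only [pairing]
    push_cast
    rfl
  have h' : ∀ s t : Fin 2, (∑ k : Quad, ((if s = 0 then (if k 0 = k 2 ∧ k 1 = k 3 then 1 else 0)
        else if k 0 = k 3 ∧ k 1 = k 2 then 1 else 0) *
      (if t = 0 then (if k 0 = k 2 ∧ k 1 = k 3 then 1 else 0)
        else if k 0 = k 3 ∧ k 1 = k 2 then 1 else 0) : ℕ)) = if s = t then 4 else 2 := by
    decide
  simp only [h, ← Nat.cast_sum, h']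
  push_cast
  rfl

theorem pairing_const (s : Fin 2) (i : Fin 2) : pairing s (fun _ => i) = 1 := by
  simp [pairing]

/-- The second moment of a random gate on `S`, where `D = 2 ^ |S|`. -/
def designKernel {S : Type} [Fintype S] (D : ℂ) (y y' : S → Quad) : ℂ :=
  ∑ s, (∏ q, pairing s (y q)) *
    ((∏ q, pairing s (y' q) - D⁻¹ * ∏ q, pairing (s + 1) (y' q)) / (D ^ 2 - 1))

/-- A product basis state overlaps both matchings with value 1, so each coefficient is `(1 -
D⁻¹)/(D² - 1) = 1/(D(D + 1))`. -/
theorem designKernel_zero {S : Type} [Fintype S] {D : ℂ} (hD : D ≠ 0) (hD' : D ^ 2 - 1 ≠ 0)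
    (y : S → Quad) : designKernel D y 0 = (D * (D + 1))⁻¹ * ∑ s, ∏ q, pairing s (y q) := by
  have h : ∀ (s : Fin 2) (q : S), pairing s ((0 : S → Quad) q) = 1 := fun s q => pairing_const s 0
  have hD'' : D + 1 ≠ 0 := fun h => hD' (by linear_combination (D - 1) * h)
  simp only [designKernel, h, Finset.prod_const_one, Finset.mul_sum]
  refine Finset.sum_congr rfl fun s _ => ?_
  field_simp
  ring

theorem sum_mul_designKernel {S : Type} [Fintype S] [DecidableEq S] {D : ℂ} (o : S → Quad → ℂ)
    (y' : S → Quad) :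
    ∑ y : S → Quad, (∏ p, o p (y p)) * designKernel D y y' =
      ∑ s, (∏ p, ∑ k, o p k * pairing s k - D⁻¹ * ∏ p, ∑ k, o p k * pairing (s + 1) k) /
        (D ^ 2 - 1) * ∏ p, pairing s (y' p) := by
  have h : ∀ s, ∑ y : S → Quad, (∏ p, o p (y p)) * ∏ p, pairing s (y p) =
      ∏ p, ∑ k, o p k * pairing s k := by
    intro s
    rw [Finset.prod_univ_sum, Fintype.piFinset_univ]
    simp only [Finset.prod_mul_distrib]
  simp only [designKernel, Finset.mul_sum]
  rw [Finset.sum_comm]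
  simp only [← mul_assoc, ← Finset.sum_mul, h]
  simp only [Fin.sum_univ_two, zero_add, show (1 : Fin 2) + 1 = 0 from rfl]
  ring

variable {ι κ S Q : Type} [Fintype ι] [DecidableEq ι] [Fintype κ] [DecidableEq κ] [Fintype S]
  [DecidableEq S] [Fintype Q] [DecidableEq Q]

/-- The weight of the matching `s` on a second-layer block. -/
def blockWeight (D : ℝ) (bw : ι → S ↪ Q) (G : Q → Fin 2 → ℝ) (b : ι) (s : Fin 2) : ℝ :=
  (∏ p, G (bw b p) s - D⁻¹ * ∏ p, G (bw b p) (s + 1)) / (D ^ 2 - 1)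

/-- The interaction of the matchings around a first-layer block. -/
def vertexWeight (D : ℝ) (f : S → Fin 2) : ℝ :=
  (D * (D + 1))⁻¹ * ∑ s, ∏ p, if f p = s then 4 else 2

/-- Passage to the spin model. Contracting the observable with the second layer leaves a sum over
one matching per block (`step1`); contracting those matchings with the first layer and the zero
input gives one coupling per first-layer block (`step2`). Sites outside the first layer see the zero
input directly and contribute 1. -/
theorem sum_designKernel_two_layers {bw : ι → S ↪ Q} {bv : κ → S ↪ Q} (hw : DisjointBlocks bw)
    (hv : DisjointBlocks bv) {blockOf : Q → ι} (hblock : ∀ b p, blockOf (bw b p) = b)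
    (hcover : ∀ q, ∃ b p, bw b p = q) {D : ℝ} (hD : 1 < D) {o : Q → Quad → ℂ}
    {G : Q → Fin 2 → ℝ} (hG : ∀ q s, ∑ k, o q k * pairing s k = G q s) :
    ∑ z : Q → Quad, (∏ q, o q (z q)) * ∑ w : Q → Quad,
      (∏ b, designKernel (D : ℂ) (fun p => z (bw b p)) (fun p => w (bw b p))) *
        ((∏ v, designKernel (D : ℂ) (fun p => w (bv v p)) 0) *
          ∏ q : Outside bv, if w q = 0 then 1 else 0) =
      ((∑ σ : ι → Fin 2, (∏ b, blockWeight D bw G b (σ b)) *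
        ∏ v, vertexWeight D fun p => σ (blockOf (bv v p)) : ℝ) : ℂ) := by
  have hD0 : (D : ℂ) ≠ 0 := Complex.ofReal_ne_zero.2 (by linarith)
  have hD1 : (D : ℂ) ^ 2 - 1 ≠ 0 := by
    have : D ^ 2 - 1 ≠ 0 := by nlinarith
    exact_mod_cast this
  have hempty : IsEmpty (Outside bw) := ⟨fun ⟨q, hq⟩ => by
    obtain ⟨b, p, h⟩ := hcover q
    exact hq b p h⟩
  have hprodw : ∀ f : Q → ℂ, ∏ q, f q = ∏ b, ∏ p, f (bw b p) := by
    intro f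
    rw [prod_blocks hw f]
    simp
  have step1 : ∀ w : Q → Quad, ∑ z : Q → Quad, (∏ q, o q (z q)) *
      ∏ b, designKernel (D : ℂ) (fun p => z (bw b p)) (fun p => w (bw b p)) =
      ∑ σ : ι → Fin 2, (∏ b, (blockWeight D bw G b (σ b) : ℂ)) *
        ∏ q, pairing (σ (blockOf q)) (w q) := by
    intro w
    have h1 := sum_blocks hw (fun b y => (∏ p, o (bw b p) (y p)) *
      designKernel (D : ℂ) y (fun p => w (bw b p))) (fun _ (_ : Quad) => (1 : ℂ))
    simp only [Finset.univ_eq_empty, Finset.prod_empty, mul_one] at h1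
    simp only [hprodw, ← Finset.prod_mul_distrib, h1, sum_mul_designKernel, hG]
    rw [Finset.prod_univ_sum, Fintype.piFinset_univ]
    refine Finset.sum_congr rfl fun σ _ => Finset.prod_congr rfl fun b _ => ?_
    simp only [hblock, blockWeight]
    push_cast
    rfl
  have step2 : ∀ σ : ι → Fin 2, ∑ w : Q → Quad, (∏ q, pairing (σ (blockOf q)) (w q)) *
      ((∏ v, designKernel (D : ℂ) (fun p => w (bv v p)) 0) *
          ∏ q : Outside bv, if w q = 0 then 1 else 0) =
      ∏ v, ((vertexWeight D fun p => σ (blockOf (bv v p)) : ℝ) : ℂ) := by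
    intro σ
    have h1 := sum_blocks hv (fun v y => (∏ p, pairing (σ (blockOf (bv v p))) (y p)) *
      designKernel (D : ℂ) y 0)
      (fun q (k : Quad) => pairing (σ (blockOf q)) k * if k = 0 then 1 else 0)
    have h2 : ∀ q : Q, ∑ k : Quad, (pairing (σ (blockOf q)) k * if k = 0 then 1 else 0) = 1 := by
      intro q
      simp only [mul_ite, mul_one, mul_zero, Finset.sum_ite_eq', Finset.mem_univ, if_true]
      exact pairing_const _ 0
    simp only [h2, Finset.prod_const_one, mul_one] at h1
    simp only [Finset.prod_mul_distrib] at h1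
    have h3 : ∀ v : κ, ∑ y : S → Quad, (∏ p, pairing (σ (blockOf (bv v p))) (y p)) *
        designKernel (D : ℂ) y 0 = ((vertexWeight D fun p => σ (blockOf (bv v p)) : ℝ) : ℂ) := by
      intro v
      have h4 : ∀ s : Fin 2, ∑ y : S → Quad, (∏ p, pairing (σ (blockOf (bv v p))) (y p)) *
          ∏ p, pairing s (y p) = ∏ p, if σ (blockOf (bv v p)) = s then 4 else 2 := by
        intro s
        simp only [← sum_pairing_mul, Finset.prod_univ_sum, Fintype.piFinset_univ,
          Finset.prod_mul_distrib]
      simp only [designKernel_zero hD0 hD1, vertexWeight]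
      simp only [mul_left_comm _ ((D : ℂ) * (D + 1))⁻¹, Finset.mul_sum]
      rw [Finset.sum_comm]
      simp only [← Finset.mul_sum, h4]
      push_cast
      simp only [apply_ite Complex.ofReal, Complex.ofReal_ofNat]
    simp only [h3] at h1
    rw [← h1]
    refine Finset.sum_congr rfl fun w _ => ?_
    rw [prod_blocks hv]
    ring
  calc _ = ∑ w : Q → Quad, (∑ z : Q → Quad, (∏ q, o q (z q)) *
      ∏ b, designKernel (D : ℂ) (fun p => z (bw b p)) (fun p => w (bw b p))) *
        ((∏ v, designKernel (D : ℂ) (fun p => w (bv v p)) 0) *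
          ∏ q : Outside bv, if w q = 0 then 1 else 0) := by
        simp only [Finset.mul_sum, Finset.sum_mul, mul_assoc]
        rw [Finset.sum_comm]
    _ = _ := by
        simp only [step1, Finset.sum_mul, mul_assoc]
        rw [Finset.sum_comm]
        simp only [← Finset.mul_sum, step2]
        push_cast
        rfl

/-! ### Bounding the partition function -/

-- With `g` the product of the swap overlaps, the weights are `(D² - g/D)/(D² - 1)` and `(g - D)/(D²
-- - 1)`, and all bounds follow from `D ≤ g ≤ D²`.
omit [Fintype ι] [DecidableEq ι] [DecidableEq S] [Fintype Q] [DecidableEq Q] in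
theorem blockWeight_bounds {D : ℝ} (hD : D = 2 ^ Fintype.card S) (hD1 : 1 < D) {bw : ι → S ↪ Q}
    {G : Q → Fin 2 → ℝ} {b : ι} (h0 : ∀ p, G (bw b p) 0 = 4)
    (h1 : ∀ p, 2 ≤ G (bw b p) 1 ∧ G (bw b p) 1 ≤ 4) :
    (∀ s, 0 ≤ blockWeight D bw G b s ∧ blockWeight D bw G b s ≤ 1) ∧
      blockWeight D bw G b 1 ≤ ∏ p, G (bw b p) 1 / 4 := by
  have hDD : D ^ 2 = ∏ p : S, (4 : ℝ) := by
    rw [hD, Finset.prod_const, Finset.card_univ, ← pow_mul, mul_comm, pow_mul]; norm_num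
  have hl : D ≤ ∏ p, G (bw b p) 1 := by
    have h : D = ∏ p : S, (2 : ℝ) := by rw [hD, Finset.prod_const, Finset.card_univ]
    rw [h]
    exact Finset.prod_le_prod (fun _ _ => by norm_num) fun p _ => (h1 p).1
  have hu : ∏ p, G (bw b p) 1 ≤ D ^ 2 := by
    rw [hDD]
    exact Finset.prod_le_prod (fun p _ => by linarith [(h1 p).1]) fun p _ => (h1 p).2
  have h00 : ∏ p, G (bw b p) 0 = D ^ 2 := by
    rw [hDD]
    exact Finset.prod_congr rfl fun p _ => h0 p
  have hDpos : 0 < D := by linarith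
  have hden : 0 < D ^ 2 - 1 := by nlinarith
  have hbw1 : blockWeight D bw G b 1 = (∏ p, G (bw b p) 1 - D) / (D ^ 2 - 1) := by
    rw [blockWeight, show (1 : Fin 2) + 1 = 0 from rfl, h00]
    congr 2
    field_simp
  have hbw0 : blockWeight D bw G b 0 = (D ^ 2 - D⁻¹ * ∏ p, G (bw b p) 1) / (D ^ 2 - 1) := by
    rw [blockWeight, zero_add, h00]
  set g := ∏ p, G (bw b p) 1 with hg
  have hg1 : 1 ≤ D⁻¹ * g := by
    rw [inv_mul_eq_div, le_div_iff₀ hDpos]; linarith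
  have hg2 : D⁻¹ * g ≤ D ^ 2 := by
    rw [inv_mul_eq_div, div_le_iff₀ hDpos]; nlinarith
  have hle : blockWeight D bw G b 1 ≤ ∏ p, G (bw b p) 1 / 4 := by
    rw [hbw1, Finset.prod_div_distrib, ← hDD, ← hg, div_le_div_iff₀ hden (by positivity)]
    nlinarith [mul_le_mul_of_nonneg_left hu hDpos.le]
  refine ⟨?_, hle⟩
  rw [Fin.forall_fin_two, hbw0, hbw1]
  refine ⟨⟨?_, ?_⟩, ?_, ?_⟩
  · exact div_nonneg (by linarith) hden.le
  · rw [div_le_one hden]; linarith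
  · exact div_nonneg (by linarith) hden.le
  · rw [div_le_one hden]; linarith

theorem prod_le_of_special {p₀ : S} {f : S → ℝ} {c : ℝ} (h0 : f p₀ = c)
    (h1 : ∀ p, p ≠ p₀ → f p ≤ 1) (h : ∀ p, 0 ≤ f p) : ∏ p, f p ≤ c := by
  rw [← Finset.mul_prod_erase _ _ (Finset.mem_univ p₀), h0]
  have hc : 0 ≤ c := h0 ▸ h p₀
  exact mul_le_of_le_one_right hc (Finset.prod_le_one (fun p _ => h p) fun p hp =>
    h1 p (Finset.ne_of_mem_erase hp))

-- For the block containing `A`: the overlap product for the identity vanishes, leaving only the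
-- negative correction `-g/D` in the spin-0 weight. This sign is what allows half of the
-- configurations to be discarded.
omit [Fintype ι] [DecidableEq ι] [Fintype Q] [DecidableEq Q] in
theorem blockWeight_special_bounds {D : ℝ} (hD : D = 2 ^ Fintype.card S) (hD1 : 2 ≤ D)
    {bw : ι → S ↪ Q} {G : Q → Fin 2 → ℝ} {b : ι} {p₀ : S} (h0 : G (bw b p₀) 0 = 0)
    (h1 : G (bw b p₀) 1 = 3) (h2 : ∀ p, p ≠ p₀ → 2 ≤ G (bw b p) 1 ∧ G (bw b p) 1 ≤ 4) :
    blockWeight D bw G b 0 ≤ 0 ∧ 0 ≤ blockWeight D bw G b 1 ∧ blockWeight D bw G b 1 ≤ 1 ∧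
      blockWeight D bw G b 1 = D ^ 2 / (D ^ 2 - 1) * ∏ p, G (bw b p) 1 / 4 := by
  have hDD : D ^ 2 = ∏ p : S, (4 : ℝ) := by
    rw [hD, Finset.prod_const, Finset.card_univ, ← pow_mul, mul_comm, pow_mul]; norm_num
  have hpos : ∀ p, 0 ≤ G (bw b p) 1 := by
    intro p
    by_cases h : p = p₀
    · rw [h, h1]; norm_num
    · linarith [(h2 p h).1]
  have hg0 : 0 ≤ ∏ p, G (bw b p) 1 := Finset.prod_nonneg fun p _ => hpos p
  have h00 : ∏ p, G (bw b p) 0 = 0 := Finset.prod_eq_zero (Finset.mem_univ p₀) h0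
  have hDpos : 0 < D := by linarith
  have hden : 0 < D ^ 2 - 1 := by nlinarith
  have hg1 : ∏ p, G (bw b p) 1 / 4 ≤ 3 / 4 := by
    refine prod_le_of_special (p₀ := p₀) (by rw [h1]) (fun p hp => ?_) fun p => ?_
    · linarith [(h2 p hp).2]
    · linarith [hpos p]
  rw [Finset.prod_div_distrib, ← hDD] at hg1 ⊢
  have hbw1 : blockWeight D bw G b 1 = (∏ p, G (bw b p) 1) / (D ^ 2 - 1) := by
    rw [blockWeight, show (1 : Fin 2) + 1 = 0 from rfl, h00, mul_zero, sub_zero]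
  have hbw0 : blockWeight D bw G b 0 = -(D⁻¹ * ∏ p, G (bw b p) 1) / (D ^ 2 - 1) := by
    rw [blockWeight, zero_add, h00, zero_sub]
  rw [hbw0, hbw1]
  refine ⟨?_, div_nonneg hg0 hden.le, ?_, ?_⟩
  · exact div_nonpos_of_nonpos_of_nonneg (neg_nonpos.2 (by positivity)) hden.le
  · rw [div_le_one hden]
    rw [div_le_iff₀ (by positivity)] at hg1
    nlinarith
  · field_simp

omit [DecidableEq S] in
theorem vertexWeight_nonneg {D : ℝ} (hD : 0 < D) (f : S → Fin 2) : 0 ≤ vertexWeight D f := by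
  refine mul_nonneg (by positivity) (Finset.sum_nonneg fun s _ => Finset.prod_nonneg fun p _ => ?_)
  split_ifs <;> norm_num

omit [DecidableEq S] in
theorem vertexWeight_const {D : ℝ} (hD : D = 2 ^ Fintype.card S) {f : S → Fin 2} {t : Fin 2}
    (hf : ∀ p, f p = t) : vertexWeight D f = 1 := by
  have hDpos : 0 < D := by rw [hD]; positivity
  have h4 : (4 : ℝ) ^ Fintype.card S = D ^ 2 := by
    rw [hD, ← pow_mul, mul_comm, pow_mul]; norm_num
  simp only [vertexWeight, hf]
  have h : ∑ s : Fin 2, ∏ _p : S, (if t = s then (4 : ℝ) else 2) = D ^ 2 + D := by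
    fin_cases t <;> simp [h4, hD, add_comm]
  rw [h]
  field_simp

-- Whichever matching `s` the first-layer gate carries, one of the two unequal classes disagrees
-- with it, and every site of that class loses a factor 2 against the maximum `4`. The two choices
-- of `s` give `2 D²/(D(D + 1)) ≤ 2`.
omit [DecidableEq S] in
theorem vertexWeight_le {D : ℝ} (hD : D = 2 ^ Fintype.card S) {C : Type} [Fintype C]
    [DecidableEq C] {quarter : S → C} {k : ℕ}
    (hk : ∀ c, k ≤ (Finset.univ.filter fun p => quarter p = c).card) {f : C → Fin 2} {c c' : C}
    (hf : f c ≠ f c') : vertexWeight D (fun p => f (quarter p)) ≤ 2 * (1 / 2) ^ k := by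
  have hDpos : 0 < D := by rw [hD]; positivity
  have h4 : D ^ 2 = ∏ p : S, (4 : ℝ) := by
    rw [hD, Finset.prod_const, Finset.card_univ, ← pow_mul, mul_comm, pow_mul]; norm_num
  have h : ∀ s : Fin 2, ∏ p, (if f (quarter p) = s then (4 : ℝ) else 2) ≤ D ^ 2 * (1 / 2) ^ k := by
    intro s
    obtain ⟨d, hd⟩ : ∃ d, f d ≠ s := by
      by_contra! hc
      exact hf ((hc c).trans (hc c').symm)
    calc _ ≤ ∏ p, (4 : ℝ) * if quarter p = d then 1 / 2 else 1 := by
          refine Finset.prod_le_prod (fun p _ => by split_ifs <;> norm_num) fun p _ => ?_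
          by_cases hp : quarter p = d
          · rw [if_neg (by rwa [hp]), if_pos hp]; norm_num
          · rw [if_neg hp]; split_ifs <;> norm_num
      _ = D ^ 2 * (1 / 2) ^ (Finset.univ.filter fun p => quarter p = d).card := by
          rw [Finset.prod_mul_distrib, ← h4, Finset.prod_ite, Finset.prod_const,
            Finset.prod_const_one, mul_one]
      _ ≤ _ := by
          refine mul_le_mul_of_nonneg_left ?_ (by positivity)
          exact pow_le_pow_of_le_one (by norm_num) (by norm_num) (hk d)
  have hsum : ∑ s : Fin 2, ∏ p, (if f (quarter p) = s then (4 : ℝ) else 2) ≤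
      D * (D + 1) * (2 * (1 / 2) ^ k) := by
    rw [Fin.sum_univ_two]
    have hp : (0 : ℝ) < (1 / 2) ^ k := by positivity
    nlinarith [h 0, h 1, mul_pos hDpos hp]
  rw [vertexWeight, inv_mul_le_iff₀ (by positivity)]
  exact hsum

/-- A low-temperature expansion: if `σ` is determined by its value at `a` and its differences around
the first-layer blocks, and every first-layer block with a nonzero difference costs `δ`, then the
nonconstant configurations contribute at most `(1 + 15 δ) ^ |κ| - 1`. -/
theorem partition_function_le {weight : ι → Fin 2 → ℝ} {vertex : κ → (ι → Fin 2) → ℝ} {a : ι}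
    {corner : κ → Fin 2 × Fin 2 → ι} {δ C₁ : ℝ} (hδ : 0 ≤ δ)
    (ha : weight a 0 ≤ 0) (ha' : 0 ≤ weight a 1 ∧ weight a 1 ≤ 1)
    (hb : ∀ b, b ≠ a → ∀ s, 0 ≤ weight b s ∧ weight b s ≤ 1)
    (hC₁ : ∏ b, weight b 1 ≤ C₁) (hv0 : ∀ v σ, 0 ≤ vertex v σ)
    (hv1 : ∀ v σ, (∀ c, σ (corner v c) = σ (corner v 0)) → vertex v σ = 1)
    (hvδ : ∀ v σ c, σ (corner v c) ≠ σ (corner v 0) → vertex v σ ≤ δ)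
    (hconn : ∀ σ : ι → Fin 2, (∀ v c, σ (corner v c) = σ (corner v 0)) → ∀ b, σ b = σ a) :
    ∑ σ : ι → Fin 2, (∏ b, weight b (σ b)) * ∏ v, vertex v σ ≤
      C₁ + ((1 + 15 * δ) ^ Fintype.card κ - 1) := by
  set rel : (ι → Fin 2) → κ → Fin 2 × Fin 2 → Fin 2 :=
    fun σ v c => σ (corner v c) - σ (corner v 0) with hrel
  set cost : (Fin 2 × Fin 2 → Fin 2) → ℝ := fun r => if r = 0 then 1 else δ with hcost
  have hcost0 : ∀ r, 0 ≤ cost r := fun r => by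
    simp only [hcost]; split_ifs <;> linarith
  have hvcost : ∀ v σ, vertex v σ ≤ cost (rel σ v) := by
    intro v σ
    by_cases h : ∀ c, σ (corner v c) = σ (corner v 0)
    · have h0 : rel σ v = 0 := funext fun c => sub_eq_zero.2 (h c)
      simp only [hcost]
      rw [hv1 v σ h, if_pos h0]
    · push Not at h
      obtain ⟨c, hc⟩ := h
      simp only [hcost]
      rw [if_neg]
      · exact hvδ v σ c hc
      · exact fun h0 => hc (sub_eq_zero.1 (congrFun h0 c))
  set F := Finset.univ.filter fun σ : ι → Fin 2 => σ a = 1 with hF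
  set one : ι → Fin 2 := fun _ => 1 with hone
  have honeF : one ∈ F := by simp [hF, hone]
  have hsplit : ∀ σ : ι → Fin 2, ∏ b, weight b (σ b) =
      weight a (σ a) * ∏ b ∈ Finset.univ.erase a, weight b (σ b) := fun σ =>
    (Finset.mul_prod_erase _ _ (Finset.mem_univ a)).symm
  have hrest0 : ∀ σ : ι → Fin 2, 0 ≤ ∏ b ∈ Finset.univ.erase a, weight b (σ b) := fun σ =>
    Finset.prod_nonneg fun b hb' => (hb b (Finset.ne_of_mem_erase hb') _).1
  have hrest1 : ∀ σ : ι → Fin 2, ∏ b ∈ Finset.univ.erase a, weight b (σ b) ≤ 1 := fun σ =>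
    Finset.prod_le_one (fun b hb' => (hb b (Finset.ne_of_mem_erase hb') _).1)
      fun b hb' => (hb b (Finset.ne_of_mem_erase hb') _).2
  -- Differences are additive in `σ` over `Fin 2`, so two configurations with the same differences
  -- have a difference that is constant around every block. It is therefore globally constant, and
  -- it vanishes at `a`.
  have hinj : Set.InjOn rel F := by
    intro σ hσ σ' hσ' h
    simp only [hF, Finset.coe_filter, Finset.mem_univ, true_and, Set.mem_ofPred_eq] at hσ hσ'
    have := hconn (σ - σ') fun v c => by
      have h := congrFun (congrFun h v) c
      simp only [hrel] at h
      simp only [Pi.sub_apply]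
      rw [sub_eq_sub_iff_sub_eq_sub]
      exact h
    funext b
    have hb := this b
    rwa [Pi.sub_apply, Pi.sub_apply, hσ, hσ', sub_self, sub_eq_zero] at hb
  have hsum : ∑ σ ∈ F, ∏ v, cost (rel σ v) ≤ (1 + 15 * δ) ^ Fintype.card κ := by
    -- There are `2⁴ = 16` patterns on four corners, one of them zero. Patterns nonzero at corner
    -- `0` never occur, so this is a harmless overcount.
    have h1 : ∑ r : Fin 2 × Fin 2 → Fin 2, cost r = 1 + 15 * δ := by
      rw [← Finset.add_sum_erase _ _ (Finset.mem_univ (0 : Fin 2 × Fin 2 → Fin 2)),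
        Finset.sum_congr rfl fun r hr => by
          simp only [hcost]; rw [if_neg (Finset.ne_of_mem_erase hr)]]
      simp [hcost]
    have h2 := Finset.prod_univ_sum
      (fun _ : κ => (Finset.univ : Finset (Fin 2 × Fin 2 → Fin 2))) fun _ r => cost r
    rw [Fintype.piFinset_univ] at h2
    simp only [h1, Finset.prod_const, Finset.card_univ] at h2
    -- By injectivity the sum over configurations becomes a sum over some families of patterns;
    -- dropping the constraint that they come from a `σ` makes it factorize.
    rw [h2, ← Finset.sum_image (f := fun r : κ → Fin 2 × Fin 2 → Fin 2 => ∏ v, cost (r v)) hinj]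
    exact Finset.sum_le_sum_of_subset_of_nonneg (Finset.subset_univ _) fun r _ _ =>
      Finset.prod_nonneg fun v _ => hcost0 _
  have hone1 : ∏ v, cost (rel one v) = 1 := by
    refine Finset.prod_eq_one fun v _ => ?_
    simp only [hcost]
    rw [if_pos]
    funext c
    simp [hrel, hone]
  calc ∑ σ : ι → Fin 2, (∏ b, weight b (σ b)) * ∏ v, vertex v σ
      ≤ ∑ σ ∈ F, (∏ b, weight b (σ b)) * ∏ v, vertex v σ := by
        rw [hF, Finset.sum_filter]
        refine Finset.sum_le_sum fun σ _ => ?_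
        split_ifs with h
        · exact le_rfl
        · have h0 : σ a = 0 := by
            revert h; generalize σ a = t; revert t; decide
          rw [hsplit, h0]
          exact mul_nonpos_of_nonpos_of_nonneg (mul_nonpos_of_nonpos_of_nonneg ha (hrest0 σ))
            (Finset.prod_nonneg fun v _ => hv0 v σ)
    _ = (∏ b, weight b 1) * ∏ v, vertex v one +
          ∑ σ ∈ F.erase one, (∏ b, weight b (σ b)) * ∏ v, vertex v σ :=
        (Finset.add_sum_erase _ _ honeF).symm
    _ ≤ C₁ + ∑ σ ∈ F.erase one, ∏ v, cost (rel σ v) := by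
        refine add_le_add ?_ (Finset.sum_le_sum fun σ hσ => ?_)
        · rw [Finset.prod_eq_one (f := fun v => vertex v one) fun v _ => hv1 v one fun c => rfl,
            mul_one]
          exact hC₁
        · have h1 : σ a = 1 := by
            have := Finset.mem_of_mem_erase hσ
            simpa [hF] using this
          have hw : ∏ b, weight b (σ b) ≤ 1 := by
            rw [hsplit, h1]
            exact mul_le_one₀ ha'.2 (hrest0 σ) (hrest1 σ)
          calc _ ≤ 1 * ∏ v, vertex v σ :=
                mul_le_mul_of_nonneg_right hw (Finset.prod_nonneg fun v _ => hv0 v σ)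
            _ ≤ _ := by
                rw [one_mul]
                exact Finset.prod_le_prod (fun v _ => hv0 v σ) fun v _ => hvcost v σ
    _ ≤ _ := by
        have h := Finset.add_sum_erase F (fun σ => ∏ v, cost (rel σ v)) honeF
        simp only [hone1] at h
        linarith

end PartitionFunction

/-! ### The geometry of coarse-grained circuits -/

section Geometry

variable {m τ : ℕ}

/-- The second-layer block of a site. -/
def blockOf (m τ : ℕ) (q : Site (m * τ)) : Fin m × Fin m :=
  (⟨q.1 / τ, Nat.div_lt_of_lt_mul (q.1.2.trans_eq (mul_comm m τ))⟩,
    ⟨q.2 / τ, Nat.div_lt_of_lt_mul (q.2.2.trans_eq (mul_comm m τ))⟩)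

theorem mul_add_div_of_lt {a s : ℕ} (hs : s < τ) : (a * τ + s) / τ = a := by
  rw [mul_comm, Nat.mul_add_div (by omega), Nat.div_eq_of_lt hs, add_zero]

theorem blockOf_blockW (b : Fin m × Fin m) (p : Site τ) : blockOf m τ (blockW m τ b p) = b := by
  refine Prod.ext (Fin.ext ?_) (Fin.ext ?_)
  · exact mul_add_div_of_lt p.1.2
  · exact mul_add_div_of_lt p.2.2

theorem disjointBlocks_blockW : DisjointBlocks (blockW m τ) := by
  intro a b hab s t h
  exact hab (by rw [← blockOf_blockW a s, h, blockOf_blockW])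

theorem exists_blockW_eq (q : Site (m * τ)) : ∃ p, blockW m τ (blockOf m τ q) p = q := by
  have hτ : 0 < τ := Nat.pos_of_ne_zero fun h => by
    have := q.1.2
    simp [h] at this
  refine ⟨(⟨q.1 % τ, Nat.mod_lt _ hτ⟩, ⟨q.2 % τ, Nat.mod_lt _ hτ⟩), ?_⟩
  refine Prod.ext (Fin.ext ?_) (Fin.ext ?_)
  · exact Nat.div_add_mod' _ _
  · exact Nat.div_add_mod' _ _

theorem disjointBlocks_blockV : DisjointBlocks (blockV m τ) := by
  intro a b hab s t h
  have key : ∀ {x y s t : ℕ}, s < τ → t < τ → x * τ + τ / 2 + s = y * τ + τ / 2 + t → x = y := by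
    intro x y s t hs ht h
    rw [← mul_add_div_of_lt (a := x) hs, ← mul_add_div_of_lt (a := y) ht]
    congr 1
    omega
  have h1 := congrArg (fun q : Site (m * τ) => (q.1 : ℕ)) h
  have h2 := congrArg (fun q : Site (m * τ) => (q.2 : ℕ)) h
  exact hab (Prod.ext (Fin.ext (key s.1.2 t.1.2 h1)) (Fin.ext (key s.2.2 t.2.2 h2)))

/-- The four second-layer blocks which meet a first-layer block. -/
def corner (m : ℕ) (v : Fin (m - 1) × Fin (m - 1)) (c : Fin 2 × Fin 2) : Fin m × Fin m :=
  (⟨v.1 + c.1, by omega⟩, ⟨v.2 + c.2, by omega⟩)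

/-- The half of a first-layer block, in one direction, to which a coordinate belongs. -/
def half (s : Fin τ) : Fin 2 := if (s : ℕ) < τ - τ / 2 then 0 else 1

/-- The quarter of a first-layer block to which a site belongs. -/
def quarter (p : Site τ) : Fin 2 × Fin 2 := (half p.1, half p.2)

/-- Starting at offset `τ / 2`, the coordinate enters the next block exactly when `s ≥ τ - τ / 2`,
the cut used in `half`. -/
theorem shifted_div (x : ℕ) (s : Fin τ) :
    (x * τ + τ / 2 + s) / τ = x + (half s : ℕ) := by
  have hs := s.2
  unfold half
  split_ifs with h
  · rw [add_assoc]
    exact mul_add_div_of_lt (by omega)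
  · have h1 : x * τ + τ / 2 + s = (x + 1) * τ + (τ / 2 + s - τ) := by
      rw [add_mul]; omega
    rw [h1]
    exact mul_add_div_of_lt (by omega)

theorem blockOf_blockV (v : Fin (m - 1) × Fin (m - 1)) (p : Site τ) :
    blockOf m τ (blockV m τ v p) = corner m v (quarter p) :=
  Prod.ext (Fin.ext (shifted_div _ _)) (Fin.ext (shifted_div _ _))

theorem card_half (c : Fin 2) : τ / 2 ≤ (Finset.univ.filter fun s : Fin τ => half s = c).card := by
  have h : ∀ (d : ℕ) (hd : d + τ / 2 ≤ τ), (∀ i, i < τ / 2 → ∀ hi : d + i < τ,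
      half (⟨d + i, hi⟩ : Fin τ) = c) →
      τ / 2 ≤ (Finset.univ.filter fun s : Fin τ => half s = c).card := by
    intro d hd h
    calc τ / 2 = (Finset.univ : Finset (Fin (τ / 2))).card := by simp
      _ ≤ _ := by
        refine Finset.card_le_card_of_injOn
          (fun i => ⟨d + i, by have := i.2; omega⟩) (fun i _ => ?_) fun i _ j _ hij => ?_
        · simp only [Finset.coe_filter, Finset.mem_univ, true_and, Set.mem_ofPred_eq]
          exact h i i.2 _
        · simp only [Fin.mk.injEq, add_right_inj] at hij
          exact Fin.ext hij
  fin_cases c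
  · refine h 0 (by omega) fun i hi hi' => ?_
    simp only [half]
    rw [if_pos (by omega)]
    rfl
  · refine h (τ - τ / 2) (by omega) fun i hi hi' => ?_
    simp only [half]
    rw [if_neg (by omega)]
    rfl

theorem card_quarter (c : Fin 2 × Fin 2) :
    (τ / 2) ^ 2 ≤ (Finset.univ.filter fun p : Site τ => quarter p = c).card := by
  have h : (Finset.univ.filter fun p : Site τ => quarter p = c) =
      (Finset.univ.filter fun s : Fin τ => half s = c.1) ×ˢ
        (Finset.univ.filter fun s : Fin τ => half s = c.2) := by
    ext p
    simp [quarter, Prod.ext_iff]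
  rw [h, Finset.card_product, sq]
  exact Nat.mul_le_mul (card_half _) (card_half _)

/-- Neighbouring second-layer blocks meet a common first-layer block. -/
theorem eq_of_forall_corner_eq {α : Type*} (σ : Fin m × Fin m → α)
    (h : ∀ v c, σ (corner m v c) = σ (corner m v 0)) (b b' : Fin m × Fin m) : σ b = σ b' := by
  have hstep : ∀ (i j : ℕ) (hi : i + 1 < m) (hj : j < m),
      σ (⟨i + 1, hi⟩, ⟨j, hj⟩) = σ (⟨i, by omega⟩, ⟨j, hj⟩) := by
    intro i j hi hj
    -- First-layer indices stop at `m - 2`; in the last column the neighbours are joined through the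
    -- first-layer block with second index `j - 1`.
    by_cases hj' : j + 1 < m
    · exact h (⟨i, by omega⟩, ⟨j, by omega⟩) (1, 0)
    · obtain ⟨j, rfl⟩ : ∃ k, j = k + 1 := ⟨j - 1, by omega⟩
      exact (h (⟨i, by omega⟩, ⟨j, by omega⟩) (1, 1)).trans
        (h (⟨i, by omega⟩, ⟨j, by omega⟩) (0, 1)).symm
  have hstep' : ∀ (i j : ℕ) (hi : i < m) (hj : j + 1 < m),
      σ (⟨i, hi⟩, ⟨j + 1, hj⟩) = σ (⟨i, hi⟩, ⟨j, by omega⟩) := by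
    intro i j hi hj
    by_cases hi' : i + 1 < m
    · exact h (⟨i, by omega⟩, ⟨j, by omega⟩) (0, 1)
    · obtain ⟨i, rfl⟩ : ∃ k, i = k + 1 := ⟨i - 1, by omega⟩
      exact (h (⟨i, by omega⟩, ⟨j, by omega⟩) (1, 1)).trans
        (h (⟨i, by omega⟩, ⟨j, by omega⟩) (1, 0)).symm
  have key : ∀ (i j : ℕ) (hi : i < m) (hj : j < m),
      σ (⟨i, hi⟩, ⟨j, hj⟩) = σ (⟨0, by omega⟩, ⟨0, by omega⟩) := by
    intro i
    induction i with
    | zero =>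
      intro j
      induction j with
      | zero => intro _ _; rfl
      | succ j ih => exact fun hi hj => (hstep' 0 j hi hj).trans (ih hi (by omega))
    | succ i ih => exact fun j hi hj => (hstep i j hi hj).trans (ih j (by omega) hj)
  exact (key b.1 b.2 b.1.2 b.2.2).trans (key b'.1 b'.2 b'.1.2 b'.2.2).symm

end Geometry

/-! ### Numerical bounds -/

/-- Here `τ² ≥ 1000 > 31²`. -/
theorem thirty_two_le_of_two_le {m τ : ℕ} (h : √(1000 * Real.logb 2 m) ≤ τ) (hm : 2 ≤ m) :
    32 ≤ τ := by
  have hlog : 1 ≤ Real.logb 2 m := by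
    rw [Real.le_logb_iff_rpow_le (by norm_num) (by positivity), Real.rpow_one]
    exact_mod_cast hm
  have hsq : 1000 * Real.logb 2 m ≤ (τ : ℝ) ^ 2 := Real.sqrt_le_left (by positivity) |>.1 h
  by_contra! hc
  have h1 : (τ : ℝ) ≤ 31 := by exact_mod_cast (by omega : τ ≤ 31)
  have h2 : (0 : ℝ) ≤ τ := by positivity
  nlinarith

theorem domain_wall_bound {m τ : ℕ} (h : √(1000 * Real.logb 2 m) ≤ τ) :
    (1 + 15 * (2 * (1 / 2) ^ (τ / 2) ^ 2) : ℝ) ^ ((m - 1) * (m - 1)) - 1 ≤ 1 / 100 := by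
  rcases Nat.lt_or_ge m 2 with hm | hm
  -- With fewer than two blocks per direction the first layer is empty and there are no domain
  -- walls.
  · have : m - 1 = 0 := by omega
    simp [this]
  set k := τ / 2 with hk
  have hsq : 1000 * Real.logb 2 m ≤ (τ : ℝ) ^ 2 := Real.sqrt_le_left (by positivity) |>.1 h
  have hτ : 32 ≤ τ := thirty_two_le_of_two_le h hm
  have hk16 : 16 ≤ k := by omega
  have hτk : (τ : ℝ) ≤ 2 * k + 1 := by exact_mod_cast (by omega : τ ≤ 2 * k + 1)
  have hk16' : (16 : ℝ) ≤ k := by exact_mod_cast hk16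
  have hτ0 : (0 : ℝ) ≤ τ := by positivity
  -- From `1000 log₂ m ≤ (2k + 1)²` and `(2k + 1)² ≤ 250 k²`, the latter with much room for `k ≥
  -- 16`.
  have hlogk : 4 * Real.logb 2 m ≤ (k : ℝ) ^ 2 := by nlinarith
  have hm4 : (m : ℝ) ^ 4 ≤ 2 ^ k ^ 2 := by
    have h1 : Real.logb 2 ((m : ℝ) ^ 4) ≤ ((k ^ 2 : ℕ) : ℝ) := by
      rw [Real.logb_pow]
      push_cast
      exact hlogk
    rw [Real.logb_le_iff_le_rpow (by norm_num) (by positivity), Real.rpow_natCast] at h1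
    exact h1
  set X : ℝ := 2 ^ k ^ 2 with hX
  have hXbig : (2 : ℝ) ^ 256 ≤ X := by
    refine pow_le_pow_right₀ (by norm_num) ?_
    nlinarith
  have hX0 : 0 < X := by positivity
  have hδ : (1 + 15 * (2 * (1 / 2) ^ k ^ 2) : ℝ) = 1 + 30 / X := by
    rw [one_div_pow, ← hX]; ring
  have hM : (((m - 1) * (m - 1) : ℕ) : ℝ) ≤ m ^ 2 := by
    rw [sq]
    exact_mod_cast Nat.mul_le_mul (Nat.sub_le m 1) (Nat.sub_le m 1)
  -- Geometric mean of `m⁴ ≤ X` and `2^256 ≤ X`: it beats the number of first-layer blocks and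
  -- leaves the factor `2^128` to absorb constants.
  have hmX : (m : ℝ) ^ 2 * 2 ^ 128 ≤ X := by
    have h1 : ((m : ℝ) ^ 2 * 2 ^ 128) ^ 2 ≤ X ^ 2 := by
      calc ((m : ℝ) ^ 2 * 2 ^ 128) ^ 2 = (m : ℝ) ^ 4 * 2 ^ 256 := by ring
        _ ≤ X * X := mul_le_mul hm4 hXbig (by positivity) hX0.le
        _ = X ^ 2 := by ring
    exact le_of_sq_le_sq h1 hX0.le
  have hexp : (1 + 30 / X) ^ ((m - 1) * (m - 1)) ≤ Real.exp (1 / 1000) := by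
    calc (1 + 30 / X) ^ ((m - 1) * (m - 1))
        ≤ Real.exp (30 / X) ^ ((m - 1) * (m - 1)) := by
          refine pow_le_pow_left₀ (by positivity) ?_ _
          linarith [Real.add_one_le_exp (30 / X)]
      _ = Real.exp (((m - 1) * (m - 1) : ℕ) * (30 / X)) := (Real.exp_nat_mul _ _).symm
      _ ≤ Real.exp (1 / 1000) := by
          refine Real.exp_le_exp.2 ?_
          rw [← mul_div_assoc, div_le_iff₀ hX0]
          nlinarith
  have he : Real.exp (1 / 1000) ≤ 1 + 1 / 100 := by
    have h1 := Real.add_one_le_exp (-(1 / 1000) : ℝ)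
    rw [Real.exp_neg, le_inv_comm₀ (by norm_num) (Real.exp_pos _)] at h1
    refine h1.trans (by norm_num)
  rw [hδ]
  linarith

/-! ### The purity as a function of the amplitudes -/

section Purity

variable {Q : Type} [Fintype Q] [DecidableEq Q]

/-- The unnormalized state after the outcome `x`. -/
def projected (ψ : Bits Q → ℂ) (B : Finset Q) (x : B → Fin 2) : Bits Q → ℂ :=
  fun z => if ∀ b : B, z b = x b then ψ z else 0

/-- The unnormalized reduced state of `A`. -/
def reduced (φ : Bits Q → ℂ) (A : Q) (a a' : Fin 2) : ℂ :=
  ∑ y : Bits {q : Q // q ≠ A}, φ (extend A a y) * star (φ (extend A a' y))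

/-- The trace of the square of the unnormalized reduced state of `A`. -/
def reducedSq (φ : Bits Q → ℂ) (A : Q) : ℝ :=
  (∑ a, ∑ a', reduced φ A a a' * reduced φ A a' a).re

theorem outcomeProj_mulVec (ψ : Bits Q → ℂ) (B : Finset Q) (x : B → Fin 2) :
    (outcomeProj B x).mulVec ψ = projected ψ B x := by
  ext z
  simp [outcomeProj, projected, Matrix.mulVec_diagonal]

theorem outcomeProb_eq (ψ : Bits Q → ℂ) (B : Finset Q) (x : B → Fin 2) :
    outcomeProb ψ B x = ∑ z, ‖projected ψ B x z‖ ^ 2 := by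
  rw [outcomeProb, outcomeProj_mulVec, dotProduct, Complex.re_sum]
  refine Finset.sum_congr rfl fun z _ => ?_
  simp only [projected, Pi.star_apply]
  split_ifs
  · rw [Complex.star_def, mul_comm, Complex.mul_conj, Complex.normSq_eq_norm_sq,
      Complex.ofReal_re]
  · simp

theorem sum_outcomeProb (ψ : Bits Q → ℂ) (B : Finset Q) :
    ∑ x, outcomeProb ψ B x = ∑ z, ‖ψ z‖ ^ 2 := by
  simp only [outcomeProb_eq]
  rw [Finset.sum_comm]
  refine Finset.sum_congr rfl fun z _ => ?_
  rw [Finset.sum_eq_single (fun b : B => z b)]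
  · simp [projected]
  · intro x _ hx
    have : ¬ ∀ b : B, z b = x b := fun h => hx (funext fun b => (h b).symm)
    simp only [projected]
    rw [if_neg this]
    simp
  · simp

theorem sum_norm_sq_outputState (U : UGroup Q) : ∑ z, ‖outputState U z‖ ^ 2 = 1 := by
  have h := congrFun (congrFun (Matrix.mem_unitaryGroup_iff'.1 U.2) 0) 0
  rw [Matrix.mul_apply, Matrix.one_apply_eq] at h
  have h' : ∑ z, ((‖outputState U z‖ ^ 2 : ℝ) : ℂ) = 1 := by
    rw [← h]
    refine Finset.sum_congr rfl fun z _ => ?_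
    simp only [outputState, Matrix.mulVec_single_one, Matrix.col_apply, Matrix.star_apply]
    rw [mul_comm, Complex.star_def, Complex.mul_conj, Complex.normSq_eq_norm_sq]
  exact_mod_cast h'

theorem reduceTo_eq (ψ : Bits Q → ℂ) (A : Q) (B : Finset Q) (x : B → Fin 2) :
    reduceTo A (outcomeProj B x * Matrix.vecMulVec ψ (star ψ) * outcomeProj B x) =
      Matrix.of (reduced (projected ψ B x) A) := by
  have h : outcomeProj B x * Matrix.vecMulVec ψ (star ψ) * outcomeProj B x =
      Matrix.vecMulVec (projected ψ B x) (star (projected ψ B x)) := by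
    ext z z'
    simp only [outcomeProj, Matrix.diagonal_mul, Matrix.mul_diagonal, Matrix.vecMulVec_apply,
      projected, Pi.star_apply]
    split_ifs <;> simp
  rw [h]
  rfl

theorem purity_postState (ψ : Bits Q → ℂ) (A : Q) (B : Finset Q) (x : B → Fin 2) :
    purity (postState ψ A B x) =
      (outcomeProb ψ B x)⁻¹ ^ 2 * reducedSq (projected ψ B x) A := by
  rw [purity, postState, reduceTo_eq, smul_mul_smul_comm, Matrix.trace_smul, ← Complex.ofReal_inv,
    ← Complex.ofReal_mul, smul_eq_mul, Complex.re_ofReal_mul, sq]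
  rfl

theorem sum_bits_eq {M : Type*} [AddCommMonoid M] (A : Q) (f : Bits Q → M) :
    ∑ z, f z = ∑ a, ∑ y, f (extend A a y) := by
  rw [← (Equiv.funSplitAt A (Fin 2)).symm.sum_comp, Fintype.sum_prod_type]
  refine Finset.sum_congr rfl fun a _ => Finset.sum_congr rfl fun y _ =>
    congrArg f (funext fun q => ?_)
  by_cases hq : q = A
  · subst hq; simp [extend]
  · simp [extend, hq]

/-- The reduced state is a positive 2 × 2 matrix whose trace is the squared norm of `φ`. The lower
bound is `2(n₀² + n₁²) ≥ (n₀ + n₁)²`; the upper one is Cauchy–Schwarz for the off-diagonal entry. -/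
theorem reducedSq_bounds (φ : Bits Q → ℂ) (A : Q) :
    (∑ z, ‖φ z‖ ^ 2) ^ 2 / 2 ≤ reducedSq φ A ∧ reducedSq φ A ≤ (∑ z, ‖φ z‖ ^ 2) ^ 2 := by
  set n : Fin 2 → ℝ := fun a => ∑ y, ‖φ (extend A a y)‖ ^ 2 with hn
  have hn0 : ∀ a, 0 ≤ n a := fun a => Finset.sum_nonneg fun y _ => by positivity
  have hdiag : ∀ a, reduced φ A a a = (n a : ℂ) := by
    intro a
    simp only [reduced, hn]
    push_cast
    refine Finset.sum_congr rfl fun y _ => ?_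
    rw [Complex.star_def, Complex.mul_conj, Complex.normSq_eq_norm_sq]
    push_cast
    rfl
  have hoff : reduced φ A 1 0 = star (reduced φ A 0 1) := by
    simp only [reduced, star_sum, star_mul, star_star]
  have hsum : ∑ z, ‖φ z‖ ^ 2 = n 0 + n 1 := by
    rw [sum_bits_eq A, Fin.sum_univ_two]
  have hsq : reducedSq φ A = n 0 ^ 2 + n 1 ^ 2 + 2 * ‖reduced φ A 0 1‖ ^ 2 := by
    simp only [reducedSq, Fin.sum_univ_two, hdiag, hoff]
    rw [mul_comm (star _), Complex.star_def, Complex.mul_conj, Complex.normSq_eq_norm_sq]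
    simp only [Complex.add_re, ← Complex.ofReal_mul, Complex.ofReal_re]
    ring
  have hcs : ‖reduced φ A 0 1‖ ^ 2 ≤ n 0 * n 1 := by
    have h1 : ‖reduced φ A 0 1‖ ≤ ∑ y, ‖φ (extend A 0 y)‖ * ‖φ (extend A 1 y)‖ := by
      refine (norm_sum_le _ _).trans (le_of_eq ?_)
      simp
    calc ‖reduced φ A 0 1‖ ^ 2 ≤ (∑ y, ‖φ (extend A 0 y)‖ * ‖φ (extend A 1 y)‖) ^ 2 :=
          pow_le_pow_left₀ (norm_nonneg _) h1 2
      _ ≤ _ := Finset.sum_mul_sq_le_sq_mul_sq _ _ _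
  rw [hsum, hsq]
  constructor
  · nlinarith [sq_nonneg (n 0 - n 1), sq_nonneg ‖reduced φ A 0 1‖]
  · nlinarith

/-- The deviation of the unnormalized purity from that of the maximally mixed state. -/
def purityExcess (ψ : Bits Q → ℂ) (A : Q) (B : Finset Q) (x : B → Fin 2) : ℝ :=
  reducedSq (projected ψ B x) A - outcomeProb ψ B x ^ 2 / 2

/-- Put `e = t - p²/2`, so that `t/p = p/2 + e/p`. If `p ≥ l` then `e/p ≤ e/l`. Otherwise `e ≤ p²/2`
gives `e/p - e/l ≤ p(l - p)/(2l) ≤ l/8`. Thus outcomes of small probability, where the division is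
dangerous, cost only `l/8`. -/
theorem purity_term_le {p t l : ℝ} (hp : 0 ≤ p) (hl : 0 < l) (h1 : p ^ 2 / 2 ≤ t)
    (h2 : t ≤ p ^ 2) : p * (p⁻¹ ^ 2 * t) ≤ p / 2 + (t - p ^ 2 / 2) / l + l / 8 := by
  rcases hp.eq_or_lt with rfl | hp
  · have : 0 ≤ (t - 0 ^ 2 / 2) / l := div_nonneg (by linarith) hl.le
    norm_num at this ⊢
    linarith
  · have e : p * (p⁻¹ ^ 2 * t) = t / p := by field_simp
    rw [e, div_add_div _ _ two_ne_zero hl.ne', div_add_div _ _ (by positivity) (by norm_num),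
      div_le_div_iff₀ hp (by positivity)]
    rcases le_total l p with h | h
    · nlinarith [mul_nonneg (sub_nonneg.2 h1) (sub_nonneg.2 h), mul_pos hp hl,
        mul_pos hl hl]
    · nlinarith [mul_nonneg (sub_nonneg.2 h2) (sub_nonneg.2 h), mul_nonneg hp.le
        (sq_nonneg (p - l / 2))]

theorem purity_term_mem {p t : ℝ} (hp : 0 ≤ p) (h1 : p ^ 2 / 2 ≤ t) (h2 : t ≤ p ^ 2) :
    0 ≤ p * (p⁻¹ ^ 2 * t) ∧ p * (p⁻¹ ^ 2 * t) ≤ p := by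
  have ht : 0 ≤ t := le_trans (by positivity) h1
  refine ⟨by positivity, ?_⟩
  rcases hp.eq_or_lt with rfl | hp
  · simp
  · have e : p * (p⁻¹ ^ 2 * t) = t / p := by field_simp
    rw [e, div_le_iff₀ hp]
    linarith

theorem outcomeProb_nonneg (ψ : Bits Q → ℂ) (B : Finset Q) (x : B → Fin 2) :
    0 ≤ outcomeProb ψ B x := by
  rw [outcomeProb_eq]
  exact Finset.sum_nonneg fun z _ => by positivity

theorem reducedSq_projected_bounds (ψ : Bits Q → ℂ) (A : Q) (B : Finset Q) (x : B → Fin 2) :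
    outcomeProb ψ B x ^ 2 / 2 ≤ reducedSq (projected ψ B x) A ∧
      reducedSq (projected ψ B x) A ≤ outcomeProb ψ B x ^ 2 := by
  rw [outcomeProb_eq]
  exact reducedSq_bounds _ _

theorem meanPurity_nonneg (A : Q) (B : Finset Q) (U : UGroup Q) : 0 ≤ meanPurity A B U := by
  refine Finset.sum_nonneg fun x _ => ?_
  rw [purity_postState]
  have h := reducedSq_projected_bounds (outputState U) A B x
  exact (purity_term_mem (outcomeProb_nonneg _ _ _) h.1 h.2).1

theorem meanPurity_le_one (A : Q) (B : Finset Q) (U : UGroup Q) : meanPurity A B U ≤ 1 := by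
  rw [← sum_norm_sq_outputState U, ← sum_outcomeProb _ B]
  refine Finset.sum_le_sum fun x _ => ?_
  rw [purity_postState]
  have h := reducedSq_projected_bounds (outputState U) A B x
  exact (purity_term_mem (outcomeProb_nonneg _ _ _) h.1 h.2).2

/-- `purity_term_le` with `l = 2 / 2^{|B|}`, twice the average outcome probability. The `p/2` terms
sum to `1/2` and the `l/8` terms to `1/4`. The factor 2 is a trade-off: a smaller `l` shrinks the
latter but magnifies the excess. -/
theorem meanPurity_le (A : Q) (B : Finset Q) (U : UGroup Q) :
    meanPurity A B U ≤ 3 / 4 + (∑ x : B → Fin 2,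
      4 ^ B.card * purityExcess (outputState U) A B x) / (2 * 2 ^ B.card) := by
  have hN : (0 : ℝ) < 2 ^ B.card := by positivity
  have hcard : (Fintype.card (B → Fin 2) : ℝ) = 2 ^ B.card := by
    simp
  have h4 : (4 : ℝ) ^ B.card = 2 ^ B.card * 2 ^ B.card := by
    rw [← mul_pow]; norm_num
  calc meanPurity A B U ≤ ∑ x : B → Fin 2, (outcomeProb (outputState U) B x / 2 +
        purityExcess (outputState U) A B x / (2 / 2 ^ B.card) + (2 / 2 ^ B.card) / 8) := by
        refine Finset.sum_le_sum fun x _ => ?_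
        rw [purity_postState]
        have h := reducedSq_projected_bounds (outputState U) A B x
        exact purity_term_le (outcomeProb_nonneg _ _ _) (by positivity) h.1 h.2
    _ = _ := by
        rw [Finset.sum_add_distrib, Finset.sum_add_distrib, ← Finset.sum_div, sum_outcomeProb,
          sum_norm_sq_outputState, ← Finset.sum_div, ← Finset.mul_sum, Finset.sum_const,
          Finset.card_univ, nsmul_eq_mul, hcard, h4]
        field_simp
        ring

/-! ### Regularity of the purity as a function of the circuit. -/

theorem continuous_outputState (z : Bits Q) : Continuous fun U : UGroup Q => outputState U z := by
  simp only [outputState, Matrix.mulVec_single_one, Matrix.col_apply]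
  exact continuous_entry z 0

theorem continuous_projected (B : Finset Q) (x : B → Fin 2) (z : Bits Q) :
    Continuous fun U : UGroup Q => projected (outputState U) B x z := by
  unfold projected
  split_ifs
  · exact continuous_outputState z
  · exact continuous_const

theorem continuous_outcomeProb (B : Finset Q) (x : B → Fin 2) :
    Continuous fun U : UGroup Q => outcomeProb (outputState U) B x := by
  simp only [outcomeProb_eq]
  exact continuous_finsetSum _ fun z _ => (continuous_projected B x z).norm.pow 2

theorem continuous_reducedSq (A : Q) (B : Finset Q) (x : B → Fin 2) :
    Continuous fun U : UGroup Q => reducedSq (projected (outputState U) B x) A := by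
  have h : ∀ a a', Continuous fun U : UGroup Q =>
      reduced (projected (outputState U) B x) A a a' := fun a a' =>
    continuous_finsetSum _ fun y _ =>
      (continuous_projected B x _).mul (continuous_projected B x _).star
  exact Complex.continuous_re.comp
    (continuous_finsetSum _ fun a _ => continuous_finsetSum _ fun a' _ => (h a a').mul (h a' a))

theorem continuous_purityExcess (A : Q) (B : Finset Q) (x : B → Fin 2) :
    Continuous fun U : UGroup Q => purityExcess (outputState U) A B x :=
  (continuous_reducedSq A B x).sub (((continuous_outcomeProb B x).pow 2).div_const 2)

/-- The inverse outcome probability need not be continuous where it vanishes, so integrability comes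
from measurability together with the bound by 1. -/
theorem measurable_meanPurity (A : Q) (B : Finset Q) :
    Measurable (meanPurity A B : UGroup Q → ℝ) := by
  refine Finset.measurable_sum _ fun x _ => ?_
  simp only [purity_postState]
  have h := (continuous_outcomeProb B x).measurable
  exact h.mul ((h.inv.pow_const 2).mul (continuous_reducedSq A B x).measurable)

theorem integrable_meanPurity (A : Q) (B : Finset Q) (μ : MeasureTheory.Measure (UGroup Q))
    [MeasureTheory.IsFiniteMeasure μ] : MeasureTheory.Integrable (meanPurity A B) μ := by
  refine MeasureTheory.Integrable.of_bound (measurable_meanPurity A B).aestronglyMeasurable 1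
    (Filter.Eventually.of_forall fun U => ?_)
  rw [Real.norm_of_nonneg (meanPurity_nonneg A B U)]
  exact meanPurity_le_one A B U

/-! ### The purity excess as a second moment -/

/-- The local factors of the observable on two copies whose expectation is the purity excess. -/
def localObservable (A : Q) (B : Finset Q) (x : B → Fin 2) (q : Q) (k : Quad) : ℂ :=
  if q = A then pairing 1 k - 1 / 2 * pairing 0 k
  else if h : q ∈ B then 4 * if ∀ i, k i = x ⟨q, h⟩ then 1 else 0
  else pairing 0 k

/-- The overlaps of the local factors with the two matchings. -/
def localOverlap (A : Q) (B : Finset Q) (q : Q) (s : Fin 2) : ℝ :=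
  if q = A then (if s = 0 then 0 else 3) else if q ∈ B then 4 else if s = 0 then 4 else 2

omit [Fintype Q] in
-- Subtracting half the identity at `A` yields `2 - 4/2 = 0` against the identity and `4 - 2/2 = 3`
-- against the swap. A measured qubit gives 4 in both cases and so does not distinguish the spins; a
-- site of `C` favours the identity, `4` against `2`.
theorem sum_localObservable (A : Q) (B : Finset Q) (x : B → Fin 2) (q : Q) (s : Fin 2) :
    ∑ k, localObservable A B x q k * pairing s k = localOverlap A B q s := by
  unfold localObservable localOverlap
  by_cases hA : q = A
  · simp only [if_pos hA, sub_mul, mul_assoc, Finset.sum_sub_distrib, ← Finset.mul_sum,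
      sum_pairing_mul]
    fin_cases s <;> norm_num
  by_cases hB : q ∈ B
  · simp only [if_neg hA, dif_pos hB, if_pos hB]
    rw [Finset.sum_eq_single fun _ => x ⟨q, hB⟩]
    · simp [pairing_const]
    · intro k _ hk
      rw [if_neg fun h => hk (funext h)]
      simp
    · simp
  · simp only [if_neg hA, dif_neg hB, if_neg hB, sum_pairing_mul]
    fin_cases s <;> norm_num

/-- Four bit strings as one string of quadruples. -/
def quadEquiv (Q : Type) : (Q → Quad) ≃ Bits Q × Bits Q × Bits Q × Bits Q where
  toFun z := (fun q => z q 0, fun q => z q 1, fun q => z q 2, fun q => z q 3)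
  invFun y q := ![y.1 q, y.2.1 q, y.2.2.1 q, y.2.2.2 q]
  left_inv z := by
    funext q i
    fin_cases i <;> rfl
  right_inv y := rfl

theorem sum_quad_eq (F : Bits Q → Bits Q → Bits Q → Bits Q → ℂ) :
    ∑ z : Q → Quad, F (fun q => z q 0) (fun q => z q 1) (fun q => z q 2) (fun q => z q 3) =
      ∑ z₀, ∑ z₁, ∑ z₂, ∑ z₃, F z₀ z₁ z₂ z₃ := by
  refine ((quadEquiv Q).sum_comp fun y => F y.1 y.2.1 y.2.2.1 y.2.2.2).trans ?_
  simp only [Fintype.sum_prod_type]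

theorem sum_pairing_zero_mul (φ : Bits Q → ℂ) :
    ∑ z : Q → Quad, (∏ q, pairing 0 (z q)) * (φ (fun q => z q 0) * φ (fun q => z q 1) *
      star (φ (fun q => z q 2)) * star (φ (fun q => z q 3))) =
      (((∑ z, ‖φ z‖ ^ 2) ^ 2 : ℝ) : ℂ) := by
  have h : ∀ z, ((‖φ z‖ ^ 2 : ℝ) : ℂ) = φ z * star (φ z) := fun z => by
    rw [Complex.star_def, Complex.mul_conj, Complex.normSq_eq_norm_sq]
  simp only [prod_pairing_zero]
  rw [sum_quad_eq fun z₀ z₁ z₂ z₃ => (if z₀ = z₂ ∧ z₁ = z₃ then 1 else 0) *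
    (φ z₀ * φ z₁ * star (φ z₂) * star (φ z₃)), Complex.ofReal_pow, Complex.ofReal_sum, sq,
    Finset.sum_mul_sum]
  refine Finset.sum_congr rfl fun z₀ _ => Finset.sum_congr rfl fun z₁ _ => ?_
  rw [Finset.sum_eq_single z₀, Finset.sum_eq_single z₁]
  · rw [h, h]; simp only [and_self, if_true]; ring
  · intro z₃ _ hz; simp [hz.symm]
  · simp
  · intro z₂ _ hz; simp [hz.symm]
  · simp

/-- The swap trick: exchanging the two copies at `A` only, and tracing out the rest, gives the trace
of the squared reduced state. -/
theorem sum_pairing_swap_mul (φ : Bits Q → ℂ) (A : Q) :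
    ∑ z : Q → Quad, (∏ q, pairing (if q = A then 1 else 0) (z q)) *
      (φ (fun q => z q 0) * φ (fun q => z q 1) *
        star (φ (fun q => z q 2)) * star (φ (fun q => z q 3))) =
      ∑ a, ∑ a', reduced φ A a a' * reduced φ A a' a := by
  have hpair : ∀ z : Q → Quad, ∏ q, pairing (if q = A then 1 else 0) (z q) =
      if ((fun q => z q 2) = Function.update (fun q => z q 0) A (z A 1)) ∧
        (fun q => z q 3) = Function.update (fun q => z q 1) A (z A 0) then 1 else 0 := by
    intro z
    have h : ∀ q, pairing (if q = A then 1 else 0) (z q) =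
        if z q 2 = Function.update (fun q => z q 0) A (z A 1) q ∧
          z q 3 = Function.update (fun q => z q 1) A (z A 0) q then 1 else 0 := by
      intro q
      by_cases hq : q = A
      · subst hq
        simp [pairing, eq_comm, and_comm]
      · simp [pairing, hq, eq_comm]
    simp only [h, Finset.prod_ite_zero, Finset.mem_univ, true_imp_iff, Finset.prod_const_one,
      funext_iff, forall_and]
  simp only [hpair]
  rw [sum_quad_eq fun z₀ z₁ z₂ z₃ => (if z₂ = Function.update z₀ A (z₁ A) ∧
    z₃ = Function.update z₁ A (z₀ A) then 1 else 0) * (φ z₀ * φ z₁ * star (φ z₂) * star (φ z₃))]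
  have h1 : ∀ z₀ z₁ : Bits Q, ∑ z₂, ∑ z₃, (if z₂ = Function.update z₀ A (z₁ A) ∧
      z₃ = Function.update z₁ A (z₀ A) then (1 : ℂ) else 0) *
        (φ z₀ * φ z₁ * star (φ z₂) * star (φ z₃)) =
      φ z₀ * φ z₁ * star (φ (Function.update z₀ A (z₁ A))) *
        star (φ (Function.update z₁ A (z₀ A))) := by
    intro z₀ z₁
    rw [Finset.sum_eq_single (Function.update z₀ A (z₁ A)),
      Finset.sum_eq_single (Function.update z₁ A (z₀ A))]
    · simp
    · intro z₃ _ hz; simp [hz]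
    · simp
    · intro z₂ _ hz; simp [hz]
    · simp
  simp only [h1]
  have hext : ∀ a (y : Bits {q : Q // q ≠ A}), extend A a y A = a := fun a y => by simp [extend]
  have hupd : ∀ a b (y : Bits {q : Q // q ≠ A}), Function.update (extend A a y) A b =
      extend A b y := by
    intro a b y
    funext q
    by_cases hq : q = A
    · subst hq; simp [extend]
    · simp [extend, hq]
  rw [sum_bits_eq A]
  simp only [sum_bits_eq A (M := ℂ), hext, hupd, reduced, Finset.sum_mul_sum]
  refine Finset.sum_congr rfl fun a _ => ?_
  rw [Finset.sum_comm]
  refine Finset.sum_congr rfl fun a' _ => Finset.sum_congr rfl fun y _ =>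
    Finset.sum_congr rfl fun y' _ => by ring

/-- The two terms of the excess differ only at `A`, so they combine into a single product
observable; the prefactor `4^{|B|}` is spread as one factor 4 per measured qubit. -/
theorem purityExcess_eq (U : UGroup Q) {A : Q} {B : Finset Q} (hA : A ∉ B) (x : B → Fin 2) :
    ((4 ^ B.card * purityExcess (outputState U) A B x : ℝ) : ℂ) =
      ∑ z : Q → Quad, (∏ q, localObservable A B x q (z q)) * quadEntry (U : Op Q) z 0 := by
  set ψ := outputState U with hψ
  set φ := projected ψ B x with hφ
  have hout : ∀ z, (U : Op Q) z 0 = ψ z := fun z => by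
    simp [hψ, outputState]
  have hquad : ∀ z : Q → Quad, quadEntry (U : Op Q) z 0 = ψ (fun q => z q 0) *
      ψ (fun q => z q 1) * star (ψ (fun q => z q 2)) * star (ψ (fun q => z q 3)) := by
    intro z
    rw [quadEntry_eq, ← hout, ← hout, ← hout, ← hout]
    rfl
  have hprod : ∀ (s : Fin 2) (z : Q → Quad), ∏ q, pairing (if q = A then s else 0) (z q) =
      pairing s (z A) * ∏ q ∈ Finset.univ.erase A, pairing 0 (z q) := by
    intro s z
    rw [← Finset.mul_prod_erase _ _ (Finset.mem_univ A), if_pos rfl]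
    congr 1
    exact Finset.prod_congr rfl fun q hq => by rw [if_neg (Finset.ne_of_mem_erase hq)]
  have hterm : ∀ z : Q → Quad,
      (∏ q, localObservable A B x q (z q)) * (ψ (fun q => z q 0) *
        ψ (fun q => z q 1) * star (ψ (fun q => z q 2)) * star (ψ (fun q => z q 3))) =
      4 ^ B.card * ((∏ q, pairing (if q = A then 1 else 0) (z q) -
        1 / 2 * ∏ q, pairing (if q = A then 0 else 0) (z q)) * (φ (fun q => z q 0) *
        φ (fun q => z q 1) * star (φ (fun q => z q 2)) * star (φ (fun q => z q 3)))) := by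
    intro z
    rw [hprod, hprod, ← Finset.mul_prod_erase _ _ (Finset.mem_univ A)]
    -- If all four copies show the outcome `x` on `B`, projection is invisible and the local factors
    -- reduce to `pairing 0`. Otherwise both sides vanish.
    by_cases hz : ∀ i, ∀ b : B, z b i = x b
    · have hφi : ∀ i, φ (fun q => z q i) = ψ (fun q => z q i) := fun i => by
        simp only [hφ, projected]
        rw [if_pos (hz i)]
      have hloc : ∀ q ∈ Finset.univ.erase A, localObservable A B x q (z q) =
          (if q ∈ B then 4 else 1) * pairing 0 (z q) := by
        intro q hq
        rw [localObservable, if_neg (Finset.ne_of_mem_erase hq)]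
        by_cases hB : q ∈ B
        · have hzq : z q = fun _ => x ⟨q, hB⟩ := funext fun i => hz i ⟨q, hB⟩
          rw [dif_pos hB, if_pos hB, hzq, pairing_const]
          simp
        · rw [dif_neg hB, if_neg hB, one_mul]
      have h4 : ∏ q ∈ Finset.univ.erase A, (if q ∈ B then (4 : ℂ) else 1) = 4 ^ B.card := by
        rw [Finset.prod_ite, Finset.prod_const, Finset.prod_const_one, mul_one]
        congr 2
        ext q
        simp only [Finset.mem_filter, Finset.mem_erase, Finset.mem_univ, and_true]
        exact ⟨fun h => h.2, fun h => ⟨fun h' => hA (h' ▸ h), h⟩⟩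
      rw [Finset.prod_congr rfl hloc, Finset.prod_mul_distrib, h4, hφi, hφi, hφi, hφi,
        localObservable, if_pos rfl]
      ring
    · push Not at hz
      obtain ⟨i, b, hb⟩ := hz
      have hφi : φ (fun q => z q i) = 0 := by
        simp only [hφ, projected]
        exact if_neg fun h => hb (h b)
      have hbA : (b : Q) ≠ A := fun h => hA (h ▸ b.2)
      have hz1 : ∏ q ∈ Finset.univ.erase A, localObservable A B x q (z q) = 0 := by
        refine Finset.prod_eq_zero (i := (b : Q))
          (Finset.mem_erase.2 ⟨hbA, Finset.mem_univ _⟩) ?_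
        rw [localObservable, if_neg hbA, dif_pos b.2,
          if_neg fun h => hb (h i), mul_zero]
      have hz2 : φ (fun q => z q 0) * φ (fun q => z q 1) * star (φ (fun q => z q 2)) *
          star (φ (fun q => z q 3)) = 0 := by
        fin_cases i <;> simp only [Fin.zero_eta, Fin.mk_one, Fin.reduceFinMk] at hφi <;>
          simp [hφi]
      rw [hz1, hz2]
      ring
  simp only [hquad, hterm, ← Finset.mul_sum, sub_mul, Finset.sum_sub_distrib, mul_assoc (1 / 2 : ℂ)]
  have e1 := sum_pairing_swap_mul φ A
  have e2 := sum_pairing_zero_mul φ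
  simp only [mul_assoc] at e1 e2 ⊢
  simp only [ite_self, e1, e2]
  -- The real part in `reducedSq` loses nothing because the reduced state is Hermitian.
  have hreal : ((reducedSq φ A : ℝ) : ℂ) = ∑ a, ∑ a', reduced φ A a a' * reduced φ A a' a := by
    rw [reducedSq]
    refine Complex.conj_eq_iff_re.1 ?_
    simp only [map_sum, map_mul]
    have hstar : ∀ a a', (starRingEnd ℂ) (reduced φ A a a') = reduced φ A a' a := by
      intro a a'
      simp [reduced, map_sum, map_mul, mul_comm]
    simp only [hstar]
    exact Finset.sum_congr rfl fun a _ => Finset.sum_congr rfl fun a' _ => mul_comm _ _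
  rw [← hreal, purityExcess, ← hφ, outcomeProb_eq, ← hφ]
  push_cast
  ring

end Purity

/-! ### The averaged purity of coarse-grained circuits -/

section Main

open MeasureTheory

variable {m τ : ℕ} {μ : Measure (UGroup (Site τ))} [IsProbabilityMeasure μ]

/-- The law of the unitary of a coarse-grained circuit. -/
def coarseLaw (m τ : ℕ) (μ : Measure (UGroup (Site τ))) [IsProbabilityMeasure μ] :
    Measure (UGroup (Site (m * τ))) :=
  ((Measure.pi fun _ : Fin (m - 1) × Fin (m - 1) => μ).prod
    (Measure.pi fun _ : Fin m × Fin m => μ)).map (coarseUnitary m τ)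

instance instProbCoarseLaw : IsProbabilityMeasure (coarseLaw m τ μ) :=
  (coarseGrained m τ μ).isProb

theorem CliffordInvariant.integral_quadEntry_coarseUnitary (hμ : CliffordInvariant μ) (hτ : 0 < τ)
    {D : ℂ} (hD : D = 2 ^ Fintype.card (Site τ)) (z y : Site (m * τ) → Quad) :
    ∫ U, quadEntry (U : Op (Site (m * τ))) z y ∂coarseLaw m τ μ =
      ∑ w : Site (m * τ) → Quad,
        (∏ b, designKernel D (fun p => z (blockW m τ b p)) (fun p => w (blockW m τ b p))) *
          ((∏ v, designKernel D (fun p => w (blockV m τ v p)) (fun p => y (blockV m τ v p))) *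
            ∏ q : Outside (blockV m τ), if w q = y q then 1 else 0) := by
  have : Nonempty (Site τ) := ⟨(⟨0, hτ⟩, ⟨0, hτ⟩)⟩
  have hk : ∀ z z' : Site τ → Quad,
      ∫ u : UGroup (Site τ), quadEntry (u : Op (Site τ)) z z' ∂μ = designKernel D z z' :=
    fun z z' => hμ.integral_quadEntry z z' hD
  have hempty : IsEmpty (Outside (blockW m τ)) := ⟨fun ⟨q, hq⟩ => by
    obtain ⟨p, h⟩ := exists_blockW_eq q
    exact hq _ p h⟩
  have hcont : ∀ (N : ℕ) (z z' : Site N → Quad),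
      Continuous fun u : UGroup (Site N) => quadEntry (u : Op (Site N)) z z' :=
    fun N z z' => continuous_quadEntry z z'
  have hmul : ∀ g : Gates m τ,
      quadEntry (coarseUnitary m τ g : Op (Site (m * τ))) z y =
        ∑ w : Site (m * τ) → Quad, quadEntry (layer (blockV m τ) g.1 : Op (Site (m * τ))) w y *
          quadEntry (layer (blockW m τ) g.2 : Op (Site (m * τ))) z w := by
    intro g
    rw [coarseUnitary, Submonoid.coe_mul, quadEntry_mul]
    exact Finset.sum_congr rfl fun w _ => mul_comm _ _
  have hmap : ∫ U, quadEntry (U : Op (Site (m * τ))) z y ∂coarseLaw m τ μ =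
      ∫ g, quadEntry (coarseUnitary m τ g : Op (Site (m * τ))) z y
        ∂((Measure.pi fun _ : Fin (m - 1) × Fin (m - 1) => μ).prod
          (Measure.pi fun _ : Fin m × Fin m => μ)) := by
    exact integral_map (continuous_coarseUnitary m τ).measurable.aemeasurable
      (hcont _ z y).aestronglyMeasurable
  rw [hmap]
  simp only [hmul]
  rw [integral_finsetSum]
  · refine Finset.sum_congr rfl fun w _ => ?_
    rw [integral_prod_mul
      (fun g => quadEntry (layer (blockV m τ) g : Op (Site (m * τ))) w y)
      (fun g => quadEntry (layer (blockW m τ) g : Op (Site (m * τ))) z w),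
      integral_quadEntry_layer disjointBlocks_blockV,
      integral_quadEntry_layer disjointBlocks_blockW]
    simp only [hk, Finset.univ_eq_empty, Finset.prod_empty, mul_one]
    rw [mul_comm]
  · intro w _
    refine integrable_of_continuous ?_
    exact ((hcont _ w y).comp ((continuous_layer _).comp continuous_fst)).mul
      ((hcont _ z w).comp ((continuous_layer _).comp continuous_snd))

theorem CliffordInvariant.integral_purityExcess (hμ : CliffordInvariant μ) (hτ : 0 < τ)
    {A : Site (m * τ)} {B : Finset (Site (m * τ))} (hA : A ∉ B) (x : B → Fin 2) :
    ∫ U, 4 ^ B.card * purityExcess (outputState U) A B x ∂coarseLaw m τ μ =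
      ∑ σ : Fin m × Fin m → Fin 2,
        (∏ b, blockWeight (2 ^ Fintype.card (Site τ)) (blockW m τ) (localOverlap A B) b (σ b)) *
          ∏ v, vertexWeight (2 ^ Fintype.card (Site τ))
            fun p : Site τ => σ (corner m v (quarter p)) := by
  have : Nonempty (Site τ) := ⟨(⟨0, hτ⟩, ⟨0, hτ⟩)⟩
  set D : ℝ := 2 ^ Fintype.card (Site τ) with hD
  have hD1 : 1 < D := one_lt_pow₀ (by norm_num) Fintype.card_ne_zero
  apply Complex.ofReal_injective
  rw [← integral_complex_ofReal]
  simp only [purityExcess_eq _ hA]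
  rw [integral_finsetSum]
  · simp only [integral_const_mul]
    have h := sum_designKernel_two_layers (disjointBlocks_blockW (m := m) (τ := τ))
      disjointBlocks_blockV blockOf_blockW (fun q => ⟨_, exists_blockW_eq q⟩) hD1
      (sum_localObservable A B x)
    simp only [blockOf_blockV] at h
    rw [← h]
    refine Finset.sum_congr rfl fun z _ => ?_
    congr 1
    exact hμ.integral_quadEntry_coarseUnitary hτ (by rw [hD]; push_cast; rfl) z 0
  · intro z _
    have hc : Continuous fun U : UGroup (Site (m * τ)) => quadEntry (U : Op (Site (m * τ))) z 0 :=
      continuous_quadEntry z 0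
    exact integrable_of_continuous (continuous_const.mul hc)

theorem CliffordInvariant.integral_purityExcess_le (hμ : CliffordInvariant μ)
    (h : √(1000 * Real.logb 2 m) ≤ τ) (hn : 4 ≤ m ^ 2 * τ ^ 2)
    {A : Site (m * τ)} {B : Finset (Site (m * τ))} (hA : A ∉ B) (hC : (insert A B)ᶜ.Nonempty)
    (x : B → Fin 2) :
    ∫ U, 4 ^ B.card * purityExcess (outputState U) A B x ∂coarseLaw m τ μ ≤ 2 / 5 := by
  -- For `m ≥ 2` the lower bound on `τ` is far stronger. For `m ≤ 1` this is where the threshold of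
  -- four qubits enters.
  have hτ : 2 ≤ τ := by
    by_contra! hc
    have hm : m ≤ 1 := by
      by_contra! hm
      have := thirty_two_le_of_two_le h hm
      omega
    nlinarith [Nat.mul_le_mul (Nat.pow_le_pow_left hm 2)
      (Nat.pow_le_pow_left (Nat.le_of_lt_succ hc) 2)]
  rw [hμ.integral_purityExcess (by omega) hA]
  have hcard : Fintype.card (Site τ) = τ * τ := by simp
  set D : ℝ := 2 ^ Fintype.card (Site τ) with hD
  -- `τ² ≥ 4`; this produces the constant `256/255` in the bound on `D²/(D² - 1)`.
  have hD16 : 16 ≤ D := by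
    rw [hD, show (16 : ℝ) = 2 ^ 4 by norm_num]
    exact pow_le_pow_right₀ (by norm_num) (by rw [hcard]; nlinarith)
  obtain ⟨q₁, hq₁⟩ := hC
  simp only [Finset.mem_compl, Finset.mem_insert, not_or] at hq₁
  obtain ⟨p₀, hp₀⟩ := exists_blockW_eq A
  have hother : ∀ b p, blockW m τ b p ≠ A →
      localOverlap A B (blockW m τ b p) 0 = 4 ∧
        2 ≤ localOverlap A B (blockW m τ b p) 1 ∧ localOverlap A B (blockW m τ b p) 1 ≤ 4 := by
    intro b p hp
    simp only [localOverlap, if_neg hp]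
    split_ifs <;> norm_num at *
  have hblock : ∀ b, b ≠ blockOf m τ A → ∀ p, blockW m τ b p ≠ A := by
    rintro b hb p rfl
    exact hb (blockOf_blockW b p).symm
  have hspecial := blockWeight_special_bounds (bw := blockW m τ) (G := localOverlap A B)
    (b := blockOf m τ A) (p₀ := p₀) hD (by linarith)
    (by rw [hp₀]; simp [localOverlap]) (by rw [hp₀]; simp [localOverlap])
    fun p hp => (hother _ p fun h => hp ((blockW m τ _).injective (h.trans hp₀.symm))).2
  have hordinary : ∀ b, b ≠ blockOf m τ A → _ := fun b hb =>
    blockWeight_bounds (bw := blockW m τ) (G := localOverlap A B) (b := b) hD (by linarith)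
      (fun p => (hother b p (hblock b hb p)).1) fun p => (hother b p (hblock b hb p)).2
  have hG0 : ∀ q, 0 ≤ localOverlap A B q 1 / 4 := by
    intro q
    unfold localOverlap
    split_ifs <;> norm_num
  -- The site `A` gives `3/4`, and a single unmeasured site `q₁` gives `1/2`. Without the latter the
  -- bound `2/5` would be out of reach.
  have hprod : ∏ q, localOverlap A B q 1 / 4 ≤ 3 / 8 := by
    rw [← Finset.mul_prod_erase _ _ (Finset.mem_univ A)]
    have h1 : localOverlap A B A 1 / 4 = 3 / 4 := by simp [localOverlap]
    have h2 : ∏ q ∈ Finset.univ.erase A, localOverlap A B q 1 / 4 ≤ 1 / 2 := by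
      rw [← Finset.mul_prod_erase _ _ (Finset.mem_erase.2 ⟨hq₁.1, Finset.mem_univ q₁⟩)]
      have h3 : localOverlap A B q₁ 1 / 4 = 1 / 2 := by
        simp only [localOverlap, if_neg hq₁.1, if_neg hq₁.2]
        norm_num
      have h4 : ∏ q ∈ (Finset.univ.erase A).erase q₁, localOverlap A B q 1 / 4 ≤ 1 := by
        refine Finset.prod_le_one (fun q _ => hG0 q) fun q _ => ?_
        unfold localOverlap
        split_ifs <;> norm_num
      rw [h3]
      linarith
    rw [h1]
    linarith
  have hC₁ : ∏ b, blockWeight D (blockW m τ) (localOverlap A B) b 1 ≤ 256 / 255 * (3 / 8) := by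
    have hDfrac : D ^ 2 / (D ^ 2 - 1) ≤ 256 / 255 := by
      rw [div_le_div_iff₀ (by nlinarith) (by norm_num)]
      nlinarith
    have hDfrac0 : 0 ≤ D ^ 2 / (D ^ 2 - 1) := div_nonneg (by positivity) (by nlinarith)
    have hempty : IsEmpty (Outside (blockW m τ)) := ⟨fun ⟨q, hq⟩ => by
      obtain ⟨p, h⟩ := exists_blockW_eq q
      exact hq _ p h⟩
    have hall : ∏ q, localOverlap A B q 1 / 4 =
        ∏ b, ∏ p, localOverlap A B (blockW m τ b p) 1 / 4 := by
      rw [prod_blocks disjointBlocks_blockW]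
      simp
    calc ∏ b, blockWeight D (blockW m τ) (localOverlap A B) b 1
        ≤ D ^ 2 / (D ^ 2 - 1) * ∏ q, localOverlap A B q 1 / 4 := by
          rw [hall, ← Finset.mul_prod_erase _ _ (Finset.mem_univ (blockOf m τ A)),
            ← Finset.mul_prod_erase _ _ (Finset.mem_univ (blockOf m τ A)), ← mul_assoc,
            ← hspecial.2.2.2]
          refine mul_le_mul_of_nonneg_left (Finset.prod_le_prod (fun b hb => ?_) fun b hb => ?_)
            hspecial.2.1
          · exact ((hordinary b (Finset.ne_of_mem_erase hb)).1 1).1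
          · exact (hordinary b (Finset.ne_of_mem_erase hb)).2
      _ ≤ 256 / 255 * (3 / 8) :=
          mul_le_mul hDfrac hprod (Finset.prod_nonneg fun q _ => hG0 q) (by norm_num)
  have hmain := partition_function_le (corner := corner m) (a := blockOf m τ A)
    (weight := blockWeight D (blockW m τ) (localOverlap A B))
    (vertex := fun v σ => vertexWeight D fun p : Site τ => σ (corner m v (quarter p)))
    (δ := 2 * (1 / 2) ^ (τ / 2) ^ 2) (by positivity) hspecial.1 ⟨hspecial.2.1, hspecial.2.2.1⟩
    (fun b hb => (hordinary b hb).1) hC₁ (fun v σ => vertexWeight_nonneg (by linarith) _)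
    (fun v σ hσ => vertexWeight_const hD fun p => hσ _)
    (fun v σ c hc => vertexWeight_le hD (quarter := quarter) (f := fun c => σ (corner m v c))
      card_quarter hc)
    (fun σ hσ b => eq_of_forall_corner_eq σ hσ _ _)
  have hwall := domain_wall_bound h
  have hcardV : Fintype.card (Fin (m - 1) × Fin (m - 1)) = (m - 1) * (m - 1) := by simp
  rw [hcardV] at hmain
  -- Numerically `256/255 · 3/8 + 1/100 < 0.39`.
  refine hmain.trans ((add_le_add_right hwall _).trans ?_)
  norm_num

theorem CliffordInvariant.integral_meanPurity_lt (hμ : CliffordInvariant μ)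
    (h : √(1000 * Real.logb 2 m) ≤ τ) (hn : 4 ≤ m ^ 2 * τ ^ 2)
    {A : Site (m * τ)} {B : Finset (Site (m * τ))} (hA : A ∉ B) (hC : (insert A B)ᶜ.Nonempty) :
    ∫ U, meanPurity A B U ∂coarseLaw m τ μ < 24 / 25 := by
  have hint : ∀ x : B → Fin 2, Integrable (fun U : UGroup (Site (m * τ)) =>
      4 ^ B.card * purityExcess (outputState U) A B x) (coarseLaw m τ μ) := fun x =>
    integrable_of_continuous (continuous_const.mul (continuous_purityExcess A B x))
  have hcard : (Fintype.card (B → Fin 2) : ℝ) = 2 ^ B.card := by simp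
  calc ∫ U, meanPurity A B U ∂coarseLaw m τ μ
      ≤ ∫ U, (3 / 4 + (∑ x : B → Fin 2,
        4 ^ B.card * purityExcess (outputState U) A B x) / (2 * 2 ^ B.card))
          ∂coarseLaw m τ μ :=
        integral_mono (integrable_meanPurity A B _)
          ((integrable_const _).add ((integrable_finsetSum _ fun x _ => hint x).div_const _))
          (meanPurity_le A B)
    _ = 3 / 4 + (∑ x : B → Fin 2, ∫ U, 4 ^ B.card * purityExcess (outputState U) A B x
          ∂coarseLaw m τ μ) / (2 * 2 ^ B.card) := by
        rw [integral_add (integrable_const _)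
          ((integrable_finsetSum _ fun x _ => hint x).div_const _), integral_const, integral_div,
          integral_finsetSum _ fun x _ => hint x]
        simp
    _ ≤ 3 / 4 + (∑ _x : B → Fin 2, (2 / 5 : ℝ)) / (2 * 2 ^ B.card) := by
        gcongr
        exact hμ.integral_purityExcess_le h hn hA hC _
    -- The value on the left is exactly `3/4 + 1/5 = 19/20`.
    _ < 24 / 25 := by
        have hN : (0 : ℝ) < 2 ^ B.card := by positivity
        rw [Finset.sum_const, Finset.card_univ, nsmul_eq_mul, hcard]
        have : (2 : ℝ) ^ B.card * (2 / 5) / (2 * 2 ^ B.card) = 1 / 5 := by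
          field_simp
        rw [this]
        norm_num

theorem longRangeMIE_coarseGrained (μ : ∀ τ : ℕ, Measure (UGroup (Site τ)))
    [∀ τ, IsProbabilityMeasure (μ τ)] (hμ : ∀ τ, CliffordInvariant (μ τ)) :
    LongRangeMIE fun p : Params 4 => coarseGrained p.1.1 p.1.2 (μ p.1.2) := by
  refine ⟨24 / 25, by norm_num, by norm_num, ?_⟩
  rintro ⟨⟨m, τ⟩, h, hn⟩ A L B _ ⟨i, j, _, _, _, _, hB⟩ hC
  have hA : A ∉ B := hB ▸ Finset.notMem_erase A _
  have hint := integrable_meanPurity (Q := Site (m * τ)) A B (coarseLaw m τ (μ τ))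
  exact ⟨hint, (hμ τ).integral_meanPurity_lt h hn hA hC⟩

end Main

end CoarseMIE

end

theorem mainTheorem4 :
    (∃ n₀ : ℕ, CoarseMIE.LongRangeMIE fun p : CoarseMIE.Params n₀ =>
      CoarseMIE.coarseUniversal p.1.1 p.1.2) ∧
    (∃ n₀ : ℕ, CoarseMIE.LongRangeMIE fun p : CoarseMIE.Params n₀ =>
      CoarseMIE.coarseClifford p.1.1 p.1.2) :=
  ⟨⟨4, CoarseMIE.longRangeMIE_coarseGrained (fun τ => CoarseMIE.haarGate (CoarseMIE.Site τ))
      fun _ => CoarseMIE.cliffordInvariant_haarGate⟩,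
    ⟨4, CoarseMIE.longRangeMIE_coarseGrained (fun τ => CoarseMIE.cliffordGate (CoarseMIE.Site τ))
      fun _ => CoarseMIE.cliffordInvariant_cliffordGate⟩⟩
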